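/- Consider the $n$-node clique in the synchronous $\mathcal{CONGEST}$ model: in every round each node may send a (possibly different) message of $O(\log n)$ bits along each of its links; local computation is free and may use private randomness, and the local random choices of different nodes and rounds are independent. An instance of \textsc{CliqueFacLoc} consists of a metric $D$ on the node set $X=\{x_1,\dots,x_n\}$ and opening costs $f_1,\dots,f_n\ge 0$ (not necessarily equal). Initially node $x_i$ knows only $n$, its identifier $i$, its opening cost $f_i$ and its distances $D(x_i,x_j)$, $1\le j\le n$. For nonempty $F\subseteq X$ let $$\mathrm{FacLoc}(F)=\sum_{x_i\in F} f_i+\sum_{j=1}^n \min_{x_i\in F} D(x_i,x_j),\qquad \mathrm{OPT}=\min_{\emptyset\ne F\subseteq X}\mathrm{FacLoc}(F).$$ The nodes have to determine a nonempty set $F$ of open nodes such that $\mathrm{FacLoc}(F)\le\alpha\cdot\mathrm{OPT}$ for a constant $\alpha$: each node irrevocably decides whether it opens, and each node that does not open decides on a nearest open node to connect to. The running time is the number of communication rounds until all nodes have decided. The numbers in the input are assumed to be representable in $O(\log n)$ bits: for a constant $b$ and for each $n$ there is a number format, known to all nodes, with codes of $b\lceil\log_2(n+1)\rceil$ bits (an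 arbitrary map from codes to real numbers), among whose values are all opening costs and all distances between distinct nodes. \textbf{Theorem.} There are absolute constants $\alpha$ and $\kappa$, and for every $b$ there is a constant $C$, such that for every such family of number formats there is a randomized algorithm on the $n$-node clique ($n\ge 1$) with messages of $\kappa\lceil\log_2(n+1)\rceil$ bits which, on every instance with $n$ nodes whose numbers are represented in the given format, always outputs a solution of cost at most $\alpha\cdot\mathrm{OPT}$ when it terminates, and whose expected running time is at most $C\cdot\max\{1,\log\log n\}$ rounds, i.e. $O(\log\log n)$ (here $\log\log n$ is read as $0$ for $n=1$). In particular it terminates with probability $1$. -/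

import Mathlib

open scoped ENNReal

noncomputable section

namespace CliqueFacLoc

/-! ### Independent local random choices -/

theorem tsum_prod_pmf {σ : Type*} : ∀ (n : ℕ) (p : Fin n → PMF σ),
    ∑' x : Fin n → σ, ∏ i, p i (x i) = 1
  | 0, p => by
      rw [tsum_eq_single (default : Fin 0 → σ) (fun b hb => absurd (Subsingleton.elim b _) hb)]
      simp
  | n + 1, p => by
      rw [← (Fin.consEquiv (fun _ : Fin (n + 1) => σ)).tsum_eq, ENNReal.tsum_prod']
      simp only [Fin.consEquiv_apply, Fin.prod_univ_succ, Fin.cons_zero, Fin.cons_succ,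
        ENNReal.tsum_mul_left]
      rw [tsum_prod_pmf n (fun i => p i.succ)]
      simp [PMF.tsum_coe]

/-- The joint law of `n` independent random variables with laws `p 0, …, p (n - 1)`. -/
def indep {σ : Type*} {n : ℕ} (p : Fin n → PMF σ) : PMF (Fin n → σ) :=
  ⟨fun x => ∏ i, p i (x i), (ENNReal.summable.hasSum_iff).2 (tsum_prod_pmf n p)⟩

/-! ### Randomized synchronous message passing on a clique -/

/-- A randomized distributed algorithm on the `n`-node clique in which, in every round, every node
may send a (possibly different) message of `B` bits along each of its links. Node identifiers are
the elements of `Fin n`. Local computation is free and may use private randomness. -/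
structure Algorithm (n B : ℕ) (In Out : Type) where
  /-- local states of a node -/
  State : Type
  /-- local computation before the first round, from the own identifier and the own input -/
  init : Fin n → In → PMF State
  /-- the message that a node in a given state sends to node `j` in the coming round -/
  send : State → Fin n → BitVec B
  /-- local computation at the end of a round, from the old state and the messages received
  (indexed by their senders) -/
  step : State → (Fin n → BitVec B) → PMF State
  /-- `some o` once the node has decided on the output `o`, and `none` before that -/
  output : State → Option Out
  /-- decisions are irrevocable -/
  output_stable : ∀ (s : State) (o : Out), output s = some o →
    ∀ (inbox : Fin n → BitVec B), ∀ s₁ ∈ (step s inbox).support, output s₁ = some o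

namespace Algorithm

variable {n B : ℕ} {In Out : Type}

/-- The law of the global configuration after `t` rounds of communication, when node `i` is given
the input `x i`. In each step, the random choices of the nodes are independent. -/
def run (A : Algorithm n B In Out) (x : Fin n → In) : ℕ → PMF (Fin n → A.State)
  | 0 => indep fun i => A.init i (x i)
  | t + 1 => (A.run x t).bind fun s => indep fun i => A.step (s i) fun j => A.send (s j) i

/-- The algorithm never produces an output outside `Good`: in every reachable configuration in
which all nodes have decided, the outputs `o i` of the nodes `i` satisfy `Good o`. -/
def Correct (A : Algorithm n B In Out) (x : Fin n → In) (Good : (Fin n → Out) → Prop) : Prop :=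
  ∀ (t : ℕ), ∀ s ∈ (A.run x t).support, ∀ o : Fin n → Out,
    (∀ i, A.output (s i) = some (o i)) → Good o

/-- The probability that the running time exceeds `t`. The running time `T` is the least number of
rounds after which all nodes have decided (`∞` if there is none); since decisions are irrevocable,
`T > t` means that some node is undecided after `t` rounds. -/
def probRoundsGt (A : Algorithm n B In Out) (x : Fin n → In) (t : ℕ) : ℝ≥0∞ :=
  (A.run x t).toOuterMeasure {s | ∃ i, A.output (s i) = none}

/-- The expected running time `E[T] = ∑ₜ P(T > t)`, in rounds. It is infinite if the algorithm
fails to terminate with positive probability. -/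
def expectedRounds (A : Algorithm n B In Out) (x : Fin n → In) : ℝ≥0∞ :=
  ∑' t : ℕ, A.probRoundsGt x t

end Algorithm

/-! ### Metric facility location on a clique -/

/-- A metric on the `n` nodes together with nonnegative, possibly non-uniform, opening costs. -/
structure Instance (n : ℕ) where
  metric : MetricSpace (Fin n)
  openCost : Fin n → ℝ
  openCost_nonneg : ∀ i, 0 ≤ openCost i

/-- What a single node knows at the beginning: its own opening cost and its distances to all
nodes. -/
structure NodeInput (n : ℕ) where
  openCost : ℝ
  distTo : Fin n → ℝ

namespace Instance

variable {n : ℕ}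

/-- The connection cost (distance) between nodes `i` and `j`. -/
def D (I : Instance n) (i j : Fin n) : ℝ := I.metric.dist i j

/-- The part of the instance that node `i` knows at the beginning. -/
def localInput (I : Instance n) (i : Fin n) : NodeInput n := ⟨I.openCost i, I.D i⟩

/-- All numbers in the instance are values of the number format `enc` with `L`-bit codes. -/
def RepresentedBy (I : Instance n) {L : ℕ} (enc : BitVec L → ℝ) : Prop :=
  (∀ i, I.openCost i ∈ Set.range enc) ∧ ∀ i j, i ≠ j → I.D i j ∈ Set.range enc

/-- `FacLoc(F)`: the opening costs of the facilities in `F` plus the distances of all nodes to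
`F`. -/
def facLoc (I : Instance n) (F : Finset (Fin n)) (hF : F.Nonempty) : ℝ :=
  ∑ i ∈ F, I.openCost i + ∑ j, F.inf' hF fun i => I.D i j

/-- The cost of an optimal solution (for `n ≥ 1` an infimum over a finite nonempty family). -/
def opt (I : Instance n) : ℝ := ⨅ F : {F : Finset (Fin n) // F.Nonempty}, I.facLoc F.1 F.2

/-- `o i` is the node by which node `i` is served; node `i` opens if it serves itself. It is
required that the set `F` of open nodes is nonempty with `FacLoc(F) ≤ α * OPT`, and that every
node is served by a nearest open node. -/
def IsApproxSolution (I : Instance n) (α : ℝ) (o : Fin n → Fin n) : Prop :=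
  ∃ (F : Finset (Fin n)) (hF : F.Nonempty),
    (∀ i, i ∈ F ↔ o i = i) ∧
    (∀ i, o i ∈ F ∧ ∀ j ∈ F, I.D i (o i) ≤ I.D i j) ∧
    I.facLoc F hF ≤ α * I.opt

end Instance

/-- The number `⌈log₂ (n + 1)⌉` of binary digits of `n`. -/
def logBits (n : ℕ) : ℕ := Nat.clog 2 (n + 1)

end CliqueFacLoc

end

open CliqueFacLoc

open scoped ENNReal

noncomputable section

namespace CliqueFacLoc

/-! ### Independent choices -/

/-! Give each facility `i` the least radius `ρ i` at which contributions of `ρ i` from all nodes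
within distance `ρ i` pay for opening it. With `r j` the minimum over `k` of `D j k + ρ k`, the sum
of `r` is at most `3 * OPT` (`sum_le_three_mul_facLoc`). Call a facility eligible if no facility
with less than half its radius is close, and let two facilities conflict if they are `Near`. If `S`
dominates the eligible facilities and `F` is a maximal independent set of the conflict graph on `S`,
then `F` costs at most `(2 + 16)` times the sum of `r`, hence at most `54 * OPT`
(`facLoc_le_of_ruling`).

It remains to find `S` so sparse that all nodes can learn its conflict graph quickly. In each phase
the eligible facilities not yet dominated join `S` with probability `p`. A phase with rate `p`
leaves at most `n / p` conflicting pairs in expectation, and the next one, with rate `p'`, selects a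
`p' ^ 2` fraction of them. Taking `p'` to be about the square root of `p` keeps this linear in `n`.
Starting near `n ^ (-1/2)` or below, the rate reaches 1 after `O(log log n)` phases, and that last
phase makes domination certain. So `S` has `O(n log log n)` conflicts in expectation
(`expect_pairs_selection_le`).

The conflicts are numbered consecutively and dealt out evenly; each node then broadcasts its share,
one per round (`exists_relay_iff`). All nodes compute the same `F` locally. Only the running time is
random. A `Scheme` describes this globally; `msg_determined` and `out_determined` certify that it is
a distributed algorithm. -/

theorem tsum_pi_prod {σ : Type*} : ∀ (n : ℕ) (g : Fin n → σ → ℝ≥0∞),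
    ∑' x : Fin n → σ, ∏ i, g i (x i) = ∏ i, ∑' s, g i s
  | 0, g => by
      rw [tsum_eq_single (default : Fin 0 → σ) (fun b hb => absurd (Subsingleton.elim b _) hb)]
      simp
  | n + 1, g => by
      rw [← (Fin.consEquiv (fun _ : Fin (n + 1) => σ)).tsum_eq, ENNReal.tsum_prod']
      simp only [Fin.consEquiv_apply, Fin.prod_univ_succ, Fin.cons_zero, Fin.cons_succ,
        ENNReal.tsum_mul_left]
      rw [tsum_pi_prod n (fun i => g i.succ), ENNReal.tsum_mul_right]

theorem indep_apply {σ : Type*} {n : ℕ} (p : Fin n → PMF σ) (x : Fin n → σ) :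
    indep p x = ∏ i, p i (x i) := rfl

theorem indep_pure {σ : Type*} {n : ℕ} (a : Fin n → σ) :
    indep (fun i => PMF.pure (a i)) = PMF.pure a := by
  classical
  ext x
  rw [indep_apply]
  simp only [PMF.pure_apply]
  by_cases h : x = a
  · simp [h]
  · obtain ⟨i, hi⟩ := Function.ne_iff.1 h
    rw [if_neg h]
    exact Finset.prod_eq_zero (Finset.mem_univ i) (if_neg hi)

/-- By `tsum_pi_prod` a product of fibre sums is a sum over tuples, in which only the tuples mapped
to `y` survive. -/
theorem indep_map {σ τ : Type*} {n : ℕ} (p : Fin n → PMF σ) (f : Fin n → σ → τ) :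
    indep (fun i => (p i).map (f i)) = (indep p).map fun x i => f i (x i) := by
  classical
  ext y
  rw [indep_apply, PMF.map_apply]
  simp only [PMF.map_apply]
  rw [← tsum_pi_prod]
  refine tsum_congr fun x => ?_
  rw [indep_apply]
  by_cases h : y = fun i => f i (x i)
  · rw [if_pos h]
    exact Finset.prod_congr rfl fun i _ => if_pos (congrFun h i)
  · rw [if_neg h]
    obtain ⟨i, hi⟩ := Function.ne_iff.1 h
    exact Finset.prod_eq_zero (Finset.mem_univ i) (if_neg hi)

/-! ### Communication schemes -/

/-- A distributed algorithm described from outside: the messages, the running time and the outputs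
are functions of the global input and of the private random seeds of the nodes, subject to the
condition that what a node sends and outputs is determined by its local input, its seed and the
messages it received before. -/
structure Scheme (n B : ℕ) (In Out : Type) where
  /-- global inputs -/
  Config : Type
  /-- private random seeds -/
  Seed : Type
  /-- the law of the seed of a node -/
  law : PMF Seed
  /-- the part of the input known to a node -/
  input : Config → Fin n → In
  /-- the message sent in a given round by the first node to the second node -/
  msg : Config → (Fin n → Seed) → ℕ → Fin n → Fin n → BitVec B
  /-- the number of rounds -/
  time : Config → (Fin n → Seed) → ℕ
  /-- the outputs -/
  out : Config → (Fin n → Seed) → Fin n → Out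
  msg_determined : ∀ {c c' : Config} {ω ω' : Fin n → Seed} {t : ℕ} {i : Fin n},
    input c i = input c' i → ω i = ω' i →
    (∀ s < t, ∀ j, msg c ω s j i = msg c' ω' s j i) → msg c ω t i = msg c' ω' t i
  out_determined : ∀ {c c' : Config} {ω ω' : Fin n → Seed} {t : ℕ} {i : Fin n},
    input c i = input c' i → ω i = ω' i →
    (∀ s < t, ∀ j, msg c ω s j i = msg c' ω' s j i) → time c' ω' ≤ t → out c ω i = out c' ω' i

namespace Scheme

variable {n B : ℕ} {In Out : Type} (𝒮 : Scheme n B In Out)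

/-- The messages that node `i` receives in the first `t` rounds, the latest ones first. -/
def view (c : 𝒮.Config) (ω : Fin n → 𝒮.Seed) (i : Fin n) : ℕ → List (Fin n → BitVec B)
  | 0 => []
  | t + 1 => (fun j => 𝒮.msg c ω t j i) :: view c ω i t

@[simp] theorem length_view (c : 𝒮.Config) (ω : Fin n → 𝒮.Seed) (i : Fin n) (t : ℕ) :
    (𝒮.view c ω i t).length = t := by
  induction t with
  | zero => rfl
  | succ t ih => simp [view, ih]

theorem msg_eq_of_view_eq {c c' : 𝒮.Config} {ω ω' : Fin n → 𝒮.Seed} {i : Fin n} {t : ℕ}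
    (h : 𝒮.view c ω i t = 𝒮.view c' ω' i t) :
    ∀ s < t, ∀ j, 𝒮.msg c ω s j i = 𝒮.msg c' ω' s j i := by
  induction t with
  | zero => intro s hs; omega
  | succ t ih =>
    rw [view, view, List.cons.injEq] at h
    intro s hs j
    rcases Nat.lt_succ_iff_lt_or_eq.1 hs with hs | rfl
    · exact ih h.2 s hs j
    · exact congrFun h.1 j

/-- The local state of a node: its identifier, input and seed, and the messages received so far. -/
structure LocalState where
  id : Fin n
  input : In
  seed : 𝒮.Seed
  inboxes : List (Fin n → BitVec B)

/-- A global execution is consistent with the local state of a node. -/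
def Consistent (s : 𝒮.LocalState) (a : 𝒮.Config × (Fin n → 𝒮.Seed)) : Prop :=
  𝒮.input a.1 s.id = s.input ∧ a.2 s.id = s.seed ∧
    𝒮.view a.1 a.2 s.id s.inboxes.length = s.inboxes

/-- The local state of node `i` after `t` rounds. -/
def stateAt (c : 𝒮.Config) (ω : Fin n → 𝒮.Seed) (t : ℕ) (i : Fin n) : 𝒮.LocalState :=
  ⟨i, 𝒮.input c i, ω i, 𝒮.view c ω i t⟩

theorem consistent_stateAt (c : 𝒮.Config) (ω : Fin n → 𝒮.Seed) (t : ℕ) (i : Fin n) :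
    𝒮.Consistent (𝒮.stateAt c ω t i) (c, ω) := by
  simp [Consistent, stateAt]

open Classical in
/-- The message sent in a local state. -/
def send (s : 𝒮.LocalState) (j : Fin n) : BitVec B :=
  if h : ∃ a, 𝒮.Consistent s a then 𝒮.msg h.choose.1 h.choose.2 s.inboxes.length s.id j else 0

open Classical in
/-- The output that a node is able to infer from its local state. -/
def infer (s : 𝒮.LocalState) : Option Out :=
  if h : ∃ a, 𝒮.Consistent s a ∧ 𝒮.time a.1 a.2 ≤ s.inboxes.length then
    some (𝒮.out h.choose.1 h.choose.2 s.id) else none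

/-- The first output that a node is able to infer. -/
def firstOutput (i : Fin n) (x : In) (r : 𝒮.Seed) : List (Fin n → BitVec B) → Option Out
  | [] => 𝒮.infer ⟨i, x, r, []⟩
  | m :: l => (firstOutput i x r l).or (𝒮.infer ⟨i, x, r, m :: l⟩)

/-- The distributed algorithm that executes a scheme. -/
abbrev toAlgorithm : Algorithm n B In Out where
  State := 𝒮.LocalState
  init i x := 𝒮.law.map fun r => ⟨i, x, r, []⟩
  send := 𝒮.send
  step s m := PMF.pure ⟨s.id, s.input, s.seed, m :: s.inboxes⟩
  output s := 𝒮.firstOutput s.id s.input s.seed s.inboxes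
  output_stable := by
    intro s o ho m s₁ hs₁
    rw [PMF.support_pure, Set.mem_singleton_iff] at hs₁
    subst hs₁
    simp [firstOutput, ho]

/-- The node simulates an arbitrary execution consistent with its state; by `msg_determined` the
choice is immaterial. -/
theorem send_stateAt (c : 𝒮.Config) (ω : Fin n → 𝒮.Seed) (t : ℕ) (i j : Fin n) :
    𝒮.send (𝒮.stateAt c ω t i) j = 𝒮.msg c ω t i j := by
  have h : ∃ a, 𝒮.Consistent (𝒮.stateAt c ω t i) a := ⟨_, 𝒮.consistent_stateAt c ω t i⟩
  rw [send, dif_pos h]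
  obtain ⟨h₁, h₂, h₃⟩ := h.choose_spec
  simp only [stateAt, length_view] at h₁ h₂ h₃ ⊢
  exact congrFun (𝒮.msg_determined h₁ h₂ (𝒮.msg_eq_of_view_eq h₃)) j

/-- The simulated execution has finished, and `out_determined` asks this of only one of two matching
executions, so the inference is right even if the true execution is still running. -/
theorem infer_stateAt (c : 𝒮.Config) (ω : Fin n → 𝒮.Seed) (t : ℕ) (i : Fin n) (o : Out)
    (ho : 𝒮.infer (𝒮.stateAt c ω t i) = some o) : o = 𝒮.out c ω i := by
  rw [infer] at ho
  split_ifs at ho with h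
  obtain ⟨⟨h₁, h₂, h₃⟩, h₄⟩ := h.choose_spec
  simp only [stateAt, length_view, Option.some.injEq] at h₁ h₂ h₃ h₄ ho
  rw [← ho]
  exact (𝒮.out_determined h₁.symm h₂.symm
    (fun s hs j => (𝒮.msg_eq_of_view_eq h₃ s hs j).symm) h₄).symm

theorem infer_stateAt_ne_none (c : 𝒮.Config) (ω : Fin n → 𝒮.Seed) (t : ℕ) (i : Fin n)
    (ht : 𝒮.time c ω ≤ t) : 𝒮.infer (𝒮.stateAt c ω t i) ≠ none := by
  rw [infer, dif_pos ⟨(c, ω), 𝒮.consistent_stateAt c ω t i, by simpa [stateAt] using ht⟩]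
  simp

/-- Keeping the first inference makes outputs irrevocable even under inboxes that no execution
produces. In actual executions every inference is the true output, so nothing is lost. -/
theorem output_stateAt (c : 𝒮.Config) (ω : Fin n → 𝒮.Seed) (t : ℕ) (i : Fin n) (o : Out)
    (ho : 𝒮.toAlgorithm.output (𝒮.stateAt c ω t i) = some o) : o = 𝒮.out c ω i := by
  induction t with
  | zero => exact 𝒮.infer_stateAt c ω 0 i o ho
  | succ t ih =>
    change (𝒮.firstOutput i (𝒮.input c i) (ω i) (𝒮.view c ω i t)).or
      (𝒮.infer (𝒮.stateAt c ω (t + 1) i)) = some o at ho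
    rcases Option.or_eq_some_iff.1 ho with h | h
    · exact ih h
    · exact 𝒮.infer_stateAt c ω _ i o h.2

theorem output_stateAt_ne_none (c : 𝒮.Config) (ω : Fin n → 𝒮.Seed) (t : ℕ) (i : Fin n)
    (ht : 𝒮.time c ω ≤ t) : 𝒮.toAlgorithm.output (𝒮.stateAt c ω t i) ≠ none := by
  cases t with
  | zero => exact 𝒮.infer_stateAt_ne_none c ω 0 i ht
  | succ t =>
    change (𝒮.firstOutput i (𝒮.input c i) (ω i) (𝒮.view c ω i t)).or
      (𝒮.infer (𝒮.stateAt c ω (t + 1) i)) ≠ none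
    intro h
    exact 𝒮.infer_stateAt_ne_none c ω _ i ht (Option.or_eq_none_iff.1 h).2

/-- All randomness is drawn before the first round; afterwards every step is deterministic. -/
theorem run_toAlgorithm (c : 𝒮.Config) (t : ℕ) :
    𝒮.toAlgorithm.run (𝒮.input c) t = (indep fun _ => 𝒮.law).map fun ω => 𝒮.stateAt c ω t := by
  induction t with
  | zero => exact indep_map (fun _ => 𝒮.law) _
  | succ t ih =>
    rw [Algorithm.run, ih, PMF.bind_map, ← PMF.bind_pure_comp]
    congr 1
    funext ω
    simp only [Function.comp]
    refine (indep_pure _).trans ?_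
    congr 1
    funext i
    have : (fun j => 𝒮.toAlgorithm.send (𝒮.stateAt c ω t j) i) = fun j => 𝒮.msg c ω t j i :=
      funext fun j => 𝒮.send_stateAt c ω t j i
    rw [this]
    rfl

theorem correct_toAlgorithm (c : 𝒮.Config) {Good : (Fin n → Out) → Prop}
    (h : ∀ ω ∈ (indep fun _ : Fin n => 𝒮.law).support, Good (𝒮.out c ω)) :
    𝒮.toAlgorithm.Correct (𝒮.input c) Good := by
  intro t s hs o ho
  rw [run_toAlgorithm, PMF.mem_support_map_iff] at hs
  obtain ⟨ω, hω, rfl⟩ := hs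
  rw [funext fun i => 𝒮.output_stateAt c ω t i _ (ho i)]
  exact h ω hω

/-- The tail-sum formula, with the two sums interchanged. It is only an inequality because nodes may
be able to decide early. -/
theorem expectedRounds_toAlgorithm_le (c : 𝒮.Config) :
    𝒮.toAlgorithm.expectedRounds (𝒮.input c) ≤
      ∑' ω, (indep fun _ : Fin n => 𝒮.law) ω * (𝒮.time c ω : ℝ≥0∞) := by
  classical
  have key : ∀ t, 𝒮.toAlgorithm.probRoundsGt (𝒮.input c) t ≤
      ∑' ω, (indep fun _ : Fin n => 𝒮.law) ω * if t < 𝒮.time c ω then 1 else 0 := by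
    intro t
    rw [Algorithm.probRoundsGt, run_toAlgorithm, PMF.toOuterMeasure_map_apply,
      PMF.toOuterMeasure_apply]
    refine ENNReal.tsum_le_tsum fun ω => ?_
    rw [Set.indicator_apply]
    split_ifs with h₁ h₂ h₂
    · simp
    · obtain ⟨i, hi⟩ := h₁
      exact absurd hi (𝒮.output_stateAt_ne_none c ω t i (not_lt.1 h₂))
    · exact zero_le
    · exact zero_le
  refine (ENNReal.tsum_le_tsum key).trans ?_
  rw [ENNReal.tsum_comm]
  refine ENNReal.tsum_le_tsum fun ω => ?_
  rw [ENNReal.tsum_mul_left]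
  gcongr
  rw [tsum_eq_sum (s := Finset.range (𝒮.time c ω))
    (fun t ht => if_neg (by simpa using ht)), Finset.sum_congr rfl fun t ht =>
    if_pos (Finset.mem_range.1 ht)]
  simp

end Scheme

/-! ### Vectors of independent coins -/

theorem indep_coin_forall {n : ℕ} (μ : PMF Bool) (N : Finset (Fin n)) (v : Bool)
    [∀ b : Fin n → Bool, Decidable (∀ j ∈ N, b j = v)] :
    ∑ b : Fin n → Bool, (indep fun _ => μ) b * (if ∀ j ∈ N, b j = v then 1 else 0) =
      μ v ^ N.card := by
  have h := tsum_pi_prod n fun i x => μ x * if i ∈ N then (if x = v then 1 else 0) else 1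
  rw [tsum_fintype] at h
  calc
    _ = ∑ b : Fin n → Bool, ∏ i, (μ (b i) * if i ∈ N then (if b i = v then 1 else 0) else 1) := by
      refine Finset.sum_congr rfl fun b _ => ?_
      rw [Finset.prod_mul_distrib, indep_apply, Finset.prod_ite_mem, Finset.univ_inter,
        Finset.prod_ite_zero, Finset.prod_const_one]
      congr
    _ = ∏ i, if i ∈ N then μ v else 1 := by
      rw [h]
      refine Finset.prod_congr rfl fun i _ => ?_
      rw [tsum_fintype]
      split_ifs with hi
      · simp
      · simpa [tsum_fintype] using μ.tsum_coe
    _ = μ v ^ N.card := by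
      rw [Finset.prod_ite_mem, Finset.univ_inter, Finset.prod_const]

theorem sum_indep_coin {n : ℕ} (μ : PMF Bool) : ∑ b : Fin n → Bool, (indep fun _ => μ) b = 1 := by
  rw [← tsum_fintype (L := .unconditional _)]
  exact PMF.tsum_coe _

theorem coin_add (μ : PMF Bool) : μ true + μ false = 1 := by
  simpa [tsum_fintype] using μ.tsum_coe

theorem pow_mul_one_add_le_one {p q : ℝ≥0∞} (h : p + q = 1) (d : ℕ) :
    q ^ d * (1 + d * p) ≤ 1 := by
  have hq : q ≤ 1 := h ▸ le_add_self
  induction d with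
  | zero => simp
  | succ d ih =>
    refine le_trans ?_ ih
    rw [pow_succ, mul_assoc]
    gcongr
    calc
      q * (1 + (d + 1 : ℕ) * p) = q + q * (d * p) + q * p := by push_cast; ring
      _ ≤ q + 1 * (d * p) + 1 * p := by gcongr
      _ = (p + q) + d * p := by ring
      _ = 1 + d * p := by rw [h]

/-- A vertex with `d` neighbours survives a phase with probability at most `q ^ d`, so this bounds
its contribution to the remaining pairs by `1 / p`. -/
theorem mul_mul_pow_le_one {p q : ℝ≥0∞} (h : p + q = 1) (d : ℕ) : p * (d * q ^ d) ≤ 1 :=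
  calc
    p * (d * q ^ d) = q ^ d * (d * p) := by ring
    _ ≤ q ^ d * (1 + d * p) := by gcongr; exact le_add_self
    _ ≤ 1 := pow_mul_one_add_le_one h d

/-! ### Sparsification by sampling in phases -/

section Sampling

open Classical

variable {n : ℕ} (near : Fin n → Fin n → Prop) (V : Finset (Fin n))

/-- The elements of `A` that are different from `i` and near it. -/
def nbrs (A : Finset (Fin n)) (i : Fin n) : Finset (Fin n) := A.filter fun j => j ≠ i ∧ near i j

/-- The number of ordered pairs of distinct elements of `A` that are near each other. -/
def pairs (A : Finset (Fin n)) : ℕ := ∑ i ∈ A, (nbrs near A i).card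

/-- The elements of `V` that are not near an element of `S`. -/
def remaining (S : Finset (Fin n)) : Finset (Fin n) := V.filter fun i => ∀ j ∈ S, ¬ near i j

/-- One phase: all remaining elements whose coin shows heads are added to `S`. -/
def sample (b : Fin n → Bool) (S : Finset (Fin n)) : Finset (Fin n) :=
  S ∪ (remaining near V S).filter fun i => b i = true

/-- The elements sampled in the first `k` phases. -/
def selection : (k : ℕ) → (Fin k → Fin n → Bool) → Finset (Fin n)
  | 0, _ => ∅
  | k + 1, c => sample near V (c (Fin.last k)) (selection k (Fin.init c))

variable {near V}

theorem selection_subset : ∀ (k : ℕ) (c : Fin k → Fin n → Bool), selection near V k c ⊆ V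
  | 0, _ => Finset.empty_subset _
  | k + 1, _ => Finset.union_subset (selection_subset k _)
      ((Finset.filter_subset _ _).trans (Finset.filter_subset _ _))

theorem exists_near_selection {k : ℕ} {c : Fin (k + 1) → Fin n → Bool} (hnear : ∀ i, near i i)
    (hc : ∀ i, c (Fin.last k) i = true) {i : Fin n} (hi : i ∈ V) :
    ∃ j ∈ selection near V (k + 1) c, near i j := by
  by_cases h : i ∈ remaining near V (selection near V k (Fin.init c))
  · exact ⟨i, Finset.mem_union_right _ (Finset.mem_filter.2 ⟨h, hc i⟩), hnear i⟩
  · simp only [remaining, Finset.mem_filter, hi, true_and, not_forall, not_not] at h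
    obtain ⟨j, hj, hij⟩ := h
    exact ⟨j, Finset.mem_union_left _ hj, hij⟩

theorem card_nbrs_lt (A : Finset (Fin n)) (i : Fin n) : (nbrs near A i).card < n := by
  have : (nbrs near A i) ⊂ Finset.univ := by
    refine (Finset.ssubset_univ_iff).2 fun h => ?_
    have : i ∈ nbrs near A i := h ▸ Finset.mem_univ i
    simp [nbrs] at this
  simpa using Finset.card_lt_card this

theorem pairs_le (A : Finset (Fin n)) : pairs near A ≤ n * n := by
  refine (Finset.sum_le_card_nsmul _ _ n fun i _ => (card_nbrs_lt A i).le).trans ?_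
  rw [smul_eq_mul]
  exact Nat.mul_le_mul_right _ (by simpa using Finset.card_le_univ A)

/-- Newly sampled elements were not near `S`, so no near pair joins the old and the new part. -/
theorem pairs_sample_le (hsymm : ∀ i j, near i j → near j i) (b : Fin n → Bool)
    (S : Finset (Fin n)) :
    pairs near (sample near V b S) ≤
      pairs near S + pairs near ((remaining near V S).filter fun i => b i = true) := by
  set Q := (remaining near V S).filter fun i => b i = true with hQ
  have hfar : ∀ i ∈ Q, ∀ j ∈ S, ¬ near i j := fun i hi =>
    (Finset.mem_filter.1 (Finset.mem_filter.1 hi).1).2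
  have h₁ : ∀ i ∈ S, nbrs near (S ∪ Q) i ⊆ nbrs near S i := by
    intro i hi j hj
    simp only [nbrs, Finset.mem_filter, Finset.mem_union] at hj ⊢
    rcases hj with ⟨hj | hj, h⟩
    · exact ⟨hj, h⟩
    · exact absurd (hsymm _ _ h.2) (hfar j hj i hi)
  have h₂ : ∀ i ∈ Q, nbrs near (S ∪ Q) i ⊆ nbrs near Q i := by
    intro i hi j hj
    simp only [nbrs, Finset.mem_filter, Finset.mem_union] at hj ⊢
    rcases hj with ⟨hj | hj, h⟩
    · exact absurd h.2 (hfar i hi j hj)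
    · exact ⟨hj, h⟩
  calc
    pairs near (S ∪ Q) ≤
        ∑ i ∈ S, (nbrs near (S ∪ Q) i).card + ∑ i ∈ Q, (nbrs near (S ∪ Q) i).card := by
      rw [pairs, ← Finset.sum_union_inter]
      exact Nat.le_add_right _ _
    _ ≤ pairs near S + pairs near Q :=
      add_le_add (Finset.sum_le_sum fun i hi => Finset.card_le_card (h₁ i hi))
        (Finset.sum_le_sum fun i hi => Finset.card_le_card (h₂ i hi))

theorem sum_coin_pairs (μ : PMF Bool) (R : Finset (Fin n)) :
    ∑ b : Fin n → Bool, (indep fun _ => μ) b *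
        (pairs near (R.filter fun i => b i = true) : ℝ≥0∞) =
      μ true ^ 2 * pairs near R := by
  have h : ∀ b : Fin n → Bool, (pairs near (R.filter fun i => b i = true) : ℝ≥0∞) =
      ∑ i ∈ R, ∑ j ∈ nbrs near R i,
        if ∀ l ∈ ({i, j} : Finset (Fin n)), b l = true then 1 else 0 := by
    intro b
    rw [pairs, Finset.sum_filter]
    push_cast
    refine Finset.sum_congr rfl fun i _ => ?_
    simp only [Finset.mem_insert, Finset.mem_singleton, forall_eq_or_imp, forall_eq]
    split_ifs with hi
    · simp only [hi, true_and, Finset.sum_boole]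
      congr 2
      ext j
      simp only [nbrs, Finset.mem_filter]
      tauto
    · simp [hi]
  simp only [h, Finset.mul_sum]
  rw [Finset.sum_comm]
  simp only [pairs, Nat.cast_sum, Finset.mul_sum]
  refine Finset.sum_congr rfl fun i _ => ?_
  rw [Finset.sum_comm]
  rw [Finset.sum_congr rfl fun j hj => ?_, Finset.sum_const, nsmul_eq_mul, mul_comm]
  rw [indep_coin_forall, Finset.card_pair]
  rintro rfl
  simp [nbrs] at hj

/-- An element remains only if the coins of all its neighbours in `R` show tails; its degree
afterwards is at most its degree in `R`. -/
theorem sum_coin_pairs_remaining (μ : PMF Bool) (S : Finset (Fin n)) :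
    μ true * ∑ b : Fin n → Bool, (indep fun _ => μ) b *
        (pairs near (remaining near V (sample near V b S)) : ℝ≥0∞) ≤ n := by
  set R := remaining near V S with hR
  have h : ∀ b : Fin n → Bool,
      (pairs near (remaining near V (sample near V b S)) : ℝ≥0∞) ≤
      ∑ i ∈ R, ((nbrs near R i).card : ℝ≥0∞) * if ∀ l ∈ nbrs near R i, b l = false then 1 else 0 := by
    intro b
    have hsub : remaining near V (sample near V b S) ⊆
        R.filter fun i => ∀ l ∈ nbrs near R i, b l = false := by
      intro i hi
      simp only [remaining, Finset.mem_filter, sample, Finset.mem_union] at hi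
      refine Finset.mem_filter.2 ⟨Finset.mem_filter.2 ⟨hi.1, fun j hj => hi.2 j (Or.inl hj)⟩, ?_⟩
      intro l hl
      simp only [nbrs, Finset.mem_filter] at hl
      by_contra hb
      exact hi.2 l (Or.inr ⟨Finset.mem_filter.1 hl.1, by simpa using hb⟩) hl.2.2
    calc
      (pairs near (remaining near V (sample near V b S)) : ℝ≥0∞)
        ≤ ∑ i ∈ R.filter fun i => ∀ l ∈ nbrs near R i, b l = false,
            ((nbrs near R i).card : ℝ≥0∞) := by
          rw [pairs]
          push_cast
          refine (Finset.sum_le_sum fun i _ => ?_).trans (Finset.sum_le_sum_of_subset hsub)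
          exact_mod_cast Finset.card_le_card
            (Finset.filter_subset_filter _ (hsub.trans (Finset.filter_subset _ _)))
      _ = _ := by
          rw [Finset.sum_filter]
          simp
  calc
    _ ≤ μ true * ∑ b : Fin n → Bool, (indep fun _ => μ) b *
        ∑ i ∈ R, ((nbrs near R i).card : ℝ≥0∞) * if ∀ l ∈ nbrs near R i, b l = false then 1 else 0 := by
      gcongr with b _
      exact h b
    _ = ∑ i ∈ R, μ true * ((nbrs near R i).card * μ false ^ (nbrs near R i).card) := by
      simp only [Finset.mul_sum]
      rw [Finset.sum_comm]
      refine Finset.sum_congr rfl fun i _ => ?_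
      rw [← indep_coin_forall μ (nbrs near R i) false, Finset.mul_sum, Finset.mul_sum]
      refine Finset.sum_congr rfl fun b _ => ?_
      ring
    _ ≤ ∑ i ∈ R, 1 := Finset.sum_le_sum fun i _ => mul_mul_pow_le_one (coin_add μ) _
    _ ≤ n := by
      rw [Finset.sum_const, nsmul_eq_mul, mul_one]
      exact_mod_cast (Finset.card_le_univ R).trans (by simp)

/-- The expectation of a function of the coins in `k` phases. -/
def expect (μ : ℕ → PMF Bool) (k : ℕ) (f : (Fin k → Fin n → Bool) → ℝ≥0∞) : ℝ≥0∞ :=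
  ∑ c, (∏ l : Fin k, (indep fun _ => μ l) (c l)) * f c

theorem expect_succ (μ : ℕ → PMF Bool) (k : ℕ) (f : (Fin (k + 1) → Fin n → Bool) → ℝ≥0∞) :
    expect μ (k + 1) f = expect μ k fun c =>
      ∑ b, (indep fun _ => μ k) b * f (Fin.snoc (α := fun _ => Fin n → Bool) c b) := by
  rw [expect, ← (Fin.snocEquiv fun _ : Fin (k + 1) => Fin n → Bool).sum_comp,
    Fintype.sum_prod_type_right, expect]
  refine Finset.sum_congr rfl fun c _ => ?_
  rw [Finset.mul_sum]
  refine Finset.sum_congr rfl fun b _ => ?_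
  rw [Fin.prod_univ_castSucc]
  simp [Fin.snocEquiv, mul_assoc]

theorem expect_mono {μ : ℕ → PMF Bool} {k : ℕ} {f g : (Fin k → Fin n → Bool) → ℝ≥0∞}
    (h : ∀ c, f c ≤ g c) : expect μ k f ≤ expect μ k g :=
  Finset.sum_le_sum fun c _ => by gcongr; exact h c

theorem expect_add (μ : ℕ → PMF Bool) (k : ℕ) (f g : (Fin k → Fin n → Bool) → ℝ≥0∞) :
    (expect μ k fun c => f c + g c) = expect μ k f + expect μ k g := by
  simp only [expect, mul_add, Finset.sum_add_distrib]

theorem expect_const_mul (μ : ℕ → PMF Bool) (k : ℕ) (a : ℝ≥0∞)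
    (f : (Fin k → Fin n → Bool) → ℝ≥0∞) :
    (expect μ k fun c => a * f c) = a * expect μ k f := by
  simp only [expect, Finset.mul_sum]
  exact Finset.sum_congr rfl fun c _ => by ring

theorem expect_const (μ : ℕ → PMF Bool) (k : ℕ) (a : ℝ≥0∞) :
    expect μ k (fun _ : Fin k → Fin n → Bool => a) = a := by
  induction k with
  | zero => simp [expect]
  | succ k ih =>
    rw [expect_succ]
    simp only [← Finset.sum_mul, sum_indep_coin, one_mul]
    exact ih

theorem expect_pairs_selection_succ_le (hsymm : ∀ i j, near i j → near j i) (μ : ℕ → PMF Bool)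
    (k : ℕ) :
    (expect μ (k + 1) fun c => (pairs near (selection near V (k + 1) c) : ℝ≥0∞)) ≤
      (expect μ k fun c => (pairs near (selection near V k c) : ℝ≥0∞)) +
        μ k true ^ 2 *
          expect μ k fun c => (pairs near (remaining near V (selection near V k c)) : ℝ≥0∞) := by
  rw [expect_succ, ← expect_const_mul, ← expect_add]
  refine expect_mono fun c => ?_
  simp only [selection, Fin.init_snoc, Fin.snoc_last]
  calc
    _ ≤ ∑ b : Fin n → Bool, ((indep fun _ => μ k) b * (pairs near (selection near V k c) : ℝ≥0∞) +
          (indep fun _ => μ k) b * (pairs near ((remaining near V (selection near V k c)).filter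
            fun i => b i = true) : ℝ≥0∞)) := by
      refine Finset.sum_le_sum fun b _ => ?_
      rw [← mul_add]
      gcongr
      exact_mod_cast pairs_sample_le hsymm b _
    _ = _ := by
      rw [Finset.sum_add_distrib, ← Finset.sum_mul, sum_indep_coin, one_mul, sum_coin_pairs]

theorem expect_pairs_remaining_succ_le (μ : ℕ → PMF Bool) (k : ℕ) :
    (μ k true * expect μ (k + 1) fun c =>
      (pairs near (remaining near V (selection near V (k + 1) c)) : ℝ≥0∞)) ≤ n := by
  rw [expect_succ, ← expect_const_mul]
  refine (expect_mono fun c => ?_).trans (expect_const μ k (n : ℝ≥0∞)).le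
  simp only [selection, Fin.init_snoc, Fin.snoc_last]
  exact sum_coin_pairs_remaining (μ k) _

/-- If the squares of the sampling rates decrease slowly, then the expected number of near pairs
in the selection is at most linear in the number of nodes times the number of phases. -/
theorem expect_pairs_selection_le (hsymm : ∀ i j, near i j → near j i) (μ : ℕ → PMF Bool)
    (h₀ : μ 0 true ^ 2 * n ≤ 2) (hμ : ∀ k, μ (k + 1) true ^ 2 ≤ 2 * μ k true) (k : ℕ) :
    (expect μ k fun c => (pairs near (selection near V k c) : ℝ≥0∞)) ≤ 2 * n * k := by
  induction k with
  | zero => simp [expect, selection, pairs]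
  | succ k ih =>
    refine (expect_pairs_selection_succ_le hsymm μ k).trans ?_
    have : μ k true ^ 2 * (expect μ k fun c =>
        (pairs near (remaining near V (selection near V k c)) : ℝ≥0∞)) ≤ 2 * n := by
      cases k with
      -- Before the first phase there is only the trivial bound of `n * n` pairs, which `h₀`
      -- compensates.
      | zero =>
        calc
          _ ≤ μ 0 true ^ 2 * expect μ 0 fun _ : Fin 0 → Fin n → Bool => ((n * n : ℕ) : ℝ≥0∞) := by
            gcongr
            exact expect_mono fun c => by exact_mod_cast pairs_le _
          _ = (μ 0 true ^ 2 * n) * n := by rw [expect_const]; push_cast; ring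
          _ ≤ 2 * n := by gcongr
      -- `hμ` replaces the square of the new rate by the old rate, cancelling the factor `1 / p`
      -- left by the previous phase.
      | succ k =>
        calc
          _ ≤ (2 * μ k true) * expect μ (k + 1) fun c =>
              (pairs near (remaining near V (selection near V (k + 1) c)) : ℝ≥0∞) := by
            gcongr
            exact hμ k
          _ ≤ 2 * n := by
            rw [mul_assoc]
            gcongr
            exact expect_pairs_remaining_succ_le μ k
    calc
      _ ≤ 2 * (n : ℝ≥0∞) * k + 2 * n := add_le_add ih this
      _ = 2 * n * (k + 1 : ℕ) := by push_cast; ring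

/-- Summing over the seeds of the nodes amounts to summing over the coins of the phases. -/
theorem tsum_indep_indep (μ : ℕ → PMF Bool) (k : ℕ) (f : (Fin k → Fin n → Bool) → ℝ≥0∞) :
    ∑' ω : Fin n → Fin k → Bool, (indep fun _ => indep fun l : Fin k => μ l) ω *
        f (fun l i => ω i l) = expect μ k f := by
  rw [tsum_fintype, expect, ← (Equiv.piComm fun (_ : Fin n) (_ : Fin k) => Bool).sum_comp]
  refine Finset.sum_congr rfl fun ω _ => ?_
  simp only [indep_apply, Equiv.piComm_apply]
  rw [Finset.prod_comm]
  rfl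

end Sampling

/-! ### Radii -/

namespace NodeInput

variable {n : ℕ}

/-- The number of nodes within distance `r`. -/
def ballCard (z : NodeInput n) (r : ℝ) : ℕ := (Finset.univ.filter fun j => z.distTo j ≤ r).card

/-- `r` is the least nonnegative number such that contributions of `r` from each node within
distance `r` pay for the opening cost. -/
structure IsRadius (z : NodeInput n) (r : ℝ) : Prop where
  nonneg : 0 ≤ r
  le_mul : z.openCost ≤ r * z.ballCard r
  mul_lt : ∀ s, 0 ≤ s → s < r → s * z.ballCard s < z.openCost

end NodeInput

/-- The number described by a code of a number format and a denominator. -/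
def ratioValue {n m : ℕ} (enc : BitVec m → ℝ) (x : BitVec m × Fin (n + 1)) : ℝ := enc x.1 / x.2

namespace Instance

variable {n : ℕ} (I : Instance n)

theorem D_self (i : Fin n) : I.D i i = 0 := I.metric.dist_self i

theorem D_comm (i j : Fin n) : I.D i j = I.D j i := I.metric.dist_comm i j

theorem D_triangle (i j k : Fin n) : I.D i k ≤ I.D i j + I.D j k := I.metric.dist_triangle i j k

theorem D_nonneg (i j : Fin n) : 0 ≤ I.D i j := @dist_nonneg _ I.metric.toPseudoMetricSpace i j

theorem eq_of_D_eq_zero {i j : Fin n} (h : I.D i j = 0) : i = j :=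
  I.metric.eq_of_dist_eq_zero h

variable {I}

/-- If `s` pays for opening `i` and its ball has `c` points, then so does the larger of `f / c` and
the greatest distance within that ball. Either is a represented number over a denominator at most
`n`. -/
theorem exists_ratioValue_le {m : ℕ} {enc : BitVec m → ℝ} (hI : I.RepresentedBy enc) (i : Fin n)
    {s : ℝ} (hs : 0 ≤ s) (h : I.openCost i ≤ s * (I.localInput i).ballCard s) :
    ∃ x : BitVec m × Fin (n + 1), 0 ≤ ratioValue enc x ∧ ratioValue enc x ≤ s ∧
      I.openCost i ≤ ratioValue enc x * (I.localInput i).ballCard (ratioValue enc x) := by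
  set z := I.localInput i with hz
  set c := z.ballCard s with hc
  have hi : i ∈ Finset.univ.filter fun j => z.distTo j ≤ s := by
    simpa [hz, localInput, I.D_self] using hs
  have hc₀ : 0 < c := Finset.card_pos.2 ⟨i, hi⟩
  have hcn : c ≤ n := (Finset.card_le_univ _).trans (by simp)
  have hc₁ : (0 : ℝ) < c := by exact_mod_cast hc₀
  obtain ⟨j, hj, hmax⟩ := Finset.exists_max_image _ z.distTo ⟨i, hi⟩
  rw [Finset.mem_filter] at hj
  have hcard : ∀ r, z.distTo j ≤ r → c ≤ z.ballCard r := by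
    intro r hr
    exact Finset.card_le_card fun l hl =>
      Finset.mem_filter.2 ⟨Finset.mem_univ l, (hmax l hl).trans hr⟩
  have hf : 0 ≤ I.openCost i / c := div_nonneg (I.openCost_nonneg i) hc₁.le
  rcases le_total (z.distTo j) (I.openCost i / c) with hle | hle
  · obtain ⟨w, hw⟩ := hI.1 i
    have hx : ratioValue enc (w, (⟨c, by omega⟩ : Fin (n + 1))) = I.openCost i / c := by
      simp [ratioValue, hw]
    refine ⟨_, hx ▸ hf, hx ▸ (div_le_iff₀ hc₁).2 h, ?_⟩
    rw [hx]
    calc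
      I.openCost i = I.openCost i / c * c := by field_simp
      _ ≤ _ := by gcongr; exact hcard _ hle
  -- The format need not contain the distance 0 from `i` to itself; in that case the opening cost is
  -- 0 and its code serves instead.
  · by_cases hij : i = j
    · have h₀ : z.distTo j = 0 := by rw [← hij]; exact I.D_self i
      have h₁ : I.openCost i / c = 0 := le_antisymm (h₀ ▸ hle) hf
      have h₂ : I.openCost i = 0 := by
        rcases div_eq_zero_iff.1 h₁ with h | h
        · exact h
        · exact absurd h hc₁.ne'
      obtain ⟨w, hw⟩ := hI.1 i
      have hx : ratioValue enc (w, (⟨c, by omega⟩ : Fin (n + 1))) = 0 := by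
        simp [ratioValue, hw, h₂]
      exact ⟨_, hx.ge, hx.trans_le hs, by rw [hx, h₂, zero_mul]⟩
    · obtain ⟨w, hw⟩ := hI.2 i j hij
      have hn : 1 < n + 1 := by omega
      have hx : ratioValue enc (w, (⟨1, hn⟩ : Fin (n + 1))) = z.distTo j := by
        simp [ratioValue, hw, hz, localInput]
      refine ⟨_, hx ▸ hf.trans hle, hx ▸ hj.2, ?_⟩
      rw [hx]
      calc
        I.openCost i = I.openCost i / c * c := by field_simp
        _ ≤ _ := by gcongr; exacts [hf.trans hle, hcard _ le_rfl]

/-- The least of the finitely many feasible ratios is least among all feasible reals, since every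
feasible real has a feasible ratio below it. -/
theorem exists_isRadius {m : ℕ} {enc : BitVec m → ℝ} (hI : I.RepresentedBy enc) (i : Fin n) :
    ∃ x : BitVec m × Fin (n + 1), (I.localInput i).IsRadius (ratioValue enc x) := by
  classical
  set z := I.localInput i with hz
  have hf := I.openCost_nonneg i
  have h₁ : I.openCost i ≤ I.openCost i * z.ballCard (I.openCost i) := by
    refine le_mul_of_one_le_right hf ?_
    have : 0 < z.ballCard (I.openCost i) := Finset.card_pos.2
      ⟨i, Finset.mem_filter.2 ⟨Finset.mem_univ i, by simpa [hz, localInput, I.D_self] using hf⟩⟩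
    exact_mod_cast this
  obtain ⟨x₀, hx₀⟩ := exists_ratioValue_le hI i hf h₁
  obtain ⟨x, hx, hmin⟩ := Finset.exists_min_image
    (Finset.univ.filter fun x : BitVec m × Fin (n + 1) => 0 ≤ ratioValue enc x ∧
      I.openCost i ≤ ratioValue enc x * z.ballCard (ratioValue enc x)) (ratioValue enc)
    ⟨x₀, Finset.mem_filter.2 ⟨Finset.mem_univ _, hx₀.1, hx₀.2.2⟩⟩
  rw [Finset.mem_filter] at hx
  refine ⟨x, hx.2.1, hx.2.2, fun s hs hlt => ?_⟩
  by_contra hcon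
  obtain ⟨y, hy₀, hys, hy⟩ := exists_ratioValue_le hI i hs (not_lt.1 hcon)
  exact absurd (hmin y (Finset.mem_filter.2 ⟨Finset.mem_univ _, hy₀, hy⟩)) (by linarith)

end Instance

/-! ### Competing facilities -/

section Conflicts

variable {n : ℕ}

/-- No facility with a much smaller radius is close. -/
def IsEligible (D : Fin n → Fin n → ℝ) (ρ : Fin n → ℝ) (i : Fin n) : Prop :=
  ∀ k, D i k ≤ 2 * ρ i → ρ i ≤ 2 * ρ k

/-- The distance of two facilities is small compared with their radii. -/
def Near (D : Fin n → Fin n → ℝ) (ρ : Fin n → ℝ) (i j : Fin n) : Prop :=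
  D i j ≤ 2 * max (ρ i) (ρ j)

variable {I : Instance n} {ρ : Fin n → ℝ} (hρ : ∀ i, (I.localInput i).IsRadius (ρ i))

include hρ

theorem near_self (i : Fin n) : Near I.D ρ i i := by
  rw [Near, I.D_self, max_self]
  linarith [(hρ i).nonneg]

omit hρ in
theorem Near.symm {i j : Fin n} (h : Near I.D ρ i j) : Near I.D ρ j i := by
  rw [Near, I.D_comm, max_comm]
  exact h

theorem Near.radius_le {i j : Fin n} (h : Near I.D ρ i j) (hj : IsEligible I.D ρ j) :
    ρ j ≤ 2 * ρ i := by
  rcases le_total (ρ i) (ρ j) with hij | hij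
  · refine hj i ?_
    have := h.symm
    rwa [Near, max_eq_left hij] at this
  · linarith [(hρ i).nonneg]

theorem Near.D_le {i j : Fin n} (h : Near I.D ρ i j) (hj : IsEligible I.D ρ j) :
    I.D i j ≤ 4 * ρ i := by
  have h₁ := h.radius_le hρ hj
  have h₂ := (hρ i).nonneg
  have h₃ : max (ρ i) (ρ j) ≤ 2 * ρ i := max_le (by linarith) h₁
  rw [Near] at h
  linarith

/-- Move repeatedly to a close facility of less than half the radius. The steps are bounded by a
geometric series: `2 * ρ k` plus `4 * ρ l ≤ 2 * ρ k`. -/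
theorem exists_isEligible (k : Fin n) :
    ∃ l, IsEligible I.D ρ l ∧ I.D k l ≤ 4 * ρ k ∧ ρ l ≤ ρ k := by
  induction k using
    (Finite.wellFounded_of_trans_of_irrefl fun a b : Fin n => ρ a < ρ b).induction with
  | _ k ih =>
    by_cases hk : IsEligible I.D ρ k
    · exact ⟨k, hk, by rw [I.D_self]; linarith [(hρ k).nonneg], le_rfl⟩
    · simp only [IsEligible, not_forall, not_le] at hk
      obtain ⟨l, hkl, hlt⟩ := hk
      have hl₀ := (hρ l).nonneg
      obtain ⟨m, hm, hlm, hml⟩ := ih l (by linarith)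
      exact ⟨m, hm, by linarith [I.D_triangle k l m], by linarith⟩

/-- Points farther than `ρ k / 2` pay for `ρ k` by twice their distance. By minimality of the
radius, the nearer ones number too few for contributions of `ρ k / 2` to reach the opening cost. -/
theorem cluster_le (k : Fin n) (A : Finset (Fin n)) :
    ∑ j ∈ A, (I.D k j + ρ k) ≤ 3 * (I.openCost k + ∑ j ∈ A, I.D k j) := by
  have hk := (hρ k).nonneg
  set Q := A.filter fun j => I.D k j ≤ ρ k / 2
  have h₁ : ∑ j ∈ A, (I.D k j + ρ k) ≤
      ∑ j ∈ A, (3 * I.D k j + if I.D k j ≤ ρ k / 2 then ρ k else 0) := by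
    refine Finset.sum_le_sum fun j _ => ?_
    have := I.D_nonneg k j
    split_ifs with h
    · linarith
    · linarith
  have h₂ : (∑ j ∈ A, if I.D k j ≤ ρ k / 2 then ρ k else 0) = Q.card * ρ k := by
    rw [← Finset.sum_filter, Finset.sum_const, nsmul_eq_mul]
  have h₃ : Q.card * ρ k ≤ 2 * I.openCost k := by
    rcases hk.eq_or_lt with h₀ | h₀
    · rw [← h₀, mul_zero]
      linarith [I.openCost_nonneg k]
    · have h₄ : (Q.card : ℝ) ≤ (I.localInput k).ballCard (ρ k / 2) := by
        exact_mod_cast Finset.card_le_card (Finset.filter_subset_filter _ (Finset.subset_univ A))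
      have h₅ := (hρ k).mul_lt (ρ k / 2) (by linarith) (by linarith)
      have h₆ : ρ k / 2 * Q.card ≤ ρ k / 2 * (I.localInput k).ballCard (ρ k / 2) := by gcongr
      have h₇ : (I.localInput k).openCost = I.openCost k := rfl
      linarith
  rw [Finset.sum_add_distrib (g := fun j => ite _ _ _), h₂, ← Finset.mul_sum] at h₁
  linarith [I.openCost_nonneg k]

theorem sum_le_three_mul_facLoc {r : Fin n → ℝ} (hr : ∀ j k, r j ≤ I.D j k + ρ k)
    (F : Finset (Fin n)) (hF : F.Nonempty) : ∑ j, r j ≤ 3 * I.facLoc F hF := by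
  have : ∀ j, ∃ k ∈ F, (F.inf' hF fun i => I.D i j) = I.D k j := fun j =>
    Finset.exists_mem_eq_inf' hF _
  choose a haF ha using this
  calc
    ∑ j, r j ≤ ∑ j, (I.D (a j) j + ρ (a j)) :=
      Finset.sum_le_sum fun j _ => by rw [I.D_comm]; exact hr j (a j)
    _ = ∑ k ∈ F, ∑ j with a j = k, (I.D (a j) j + ρ (a j)) :=
      (Finset.sum_fiberwise_of_maps_to (fun j _ => haF j) _).symm
    _ = ∑ k ∈ F, ∑ j with a j = k, (I.D k j + ρ k) := by
      refine Finset.sum_congr rfl fun k _ => Finset.sum_congr rfl fun j hj => ?_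
      rw [(Finset.mem_filter.1 hj).2]
    _ ≤ ∑ k ∈ F, 3 * (I.openCost k + ∑ j with a j = k, I.D k j) :=
      Finset.sum_le_sum fun k _ => cluster_le hρ k _
    _ = 3 * (∑ k ∈ F, I.openCost k + ∑ k ∈ F, ∑ j with a j = k, I.D (a j) j) := by
      rw [← Finset.mul_sum, Finset.sum_add_distrib]
      congr 2
      refine Finset.sum_congr rfl fun k _ => Finset.sum_congr rfl fun j hj => ?_
      rw [(Finset.mem_filter.1 hj).2]
    _ = 3 * I.facLoc F hF := by
      rw [Finset.sum_fiberwise_of_maps_to (fun j _ => haF j), Instance.facLoc]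
      simp only [ha]

/-- The balls of radius `ρ i` are disjoint by independence and pay for the openings. Each `j` in
such a ball has `r j ≥ ρ i / 2`: the facility attaining `r j` is either far from `i` or, by
eligibility, has radius at least `ρ i / 2`. -/
theorem sum_openCost_le {r : Fin n → ℝ} (hr : ∀ j, ∃ k, r j = I.D j k + ρ k)
    {F : Finset (Fin n)} (hF : ∀ i ∈ F, IsEligible I.D ρ i)
    (hind : ∀ i ∈ F, ∀ j ∈ F, i ≠ j → ¬ Near I.D ρ i j) :
    ∑ i ∈ F, I.openCost i ≤ 2 * ∑ j, r j := by
  classical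
  set ball : Fin n → Finset (Fin n) := fun i => Finset.univ.filter fun j => I.D i j ≤ ρ i
  have hr₀ : ∀ j, 0 ≤ r j := by
    intro j
    obtain ⟨k, hk⟩ := hr j
    linarith [I.D_nonneg j k, (hρ k).nonneg]
  have hdisj : (F : Set (Fin n)).PairwiseDisjoint ball := by
    intro i hi k hk hik
    refine Finset.disjoint_left.2 fun j hj hj' => hind i hi k hk hik ?_
    have h₁ := (Finset.mem_filter.1 hj).2
    have h₂ := (Finset.mem_filter.1 hj').2
    have h₃ := I.D_triangle i j k
    rw [I.D_comm j k] at h₃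
    rw [Near]
    linarith [le_max_left (ρ i) (ρ k), le_max_right (ρ i) (ρ k)]
  have hball : ∀ i ∈ F, ∀ j ∈ ball i, ρ i ≤ 2 * r j := by
    intro i hi j hj
    have h₁ := (Finset.mem_filter.1 hj).2
    obtain ⟨k, hk⟩ := hr j
    have h₂ := I.D_triangle i j k
    by_cases h : I.D i k ≤ 2 * ρ i
    · linarith [hF i hi k h, I.D_nonneg j k]
    · linarith [(hρ k).nonneg, (hρ i).nonneg]
  calc
    ∑ i ∈ F, I.openCost i ≤ ∑ i ∈ F, ∑ j ∈ ball i, 2 * r j := by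
      refine Finset.sum_le_sum fun i hi => ((hρ i).le_mul).trans ?_
      calc
        ρ i * (I.localInput i).ballCard (ρ i) = ∑ j ∈ ball i, ρ i := by
          rw [Finset.sum_const, nsmul_eq_mul, mul_comm]
          rfl
        _ ≤ _ := Finset.sum_le_sum (hball i hi)
    _ = ∑ j ∈ F.biUnion ball, 2 * r j := (Finset.sum_biUnion hdisj).symm
    _ ≤ ∑ j, 2 * r j := Finset.sum_le_sum_of_subset_of_nonneg (Finset.subset_univ _)
      fun j _ _ => by linarith [hr₀ j]
    _ = 2 * ∑ j, r j := (Finset.mul_sum _ _ _).symm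

/-- Let `S` dominate the eligible facilities, and let `F` be a maximal independent subset of `S`.
Then `F` is within a constant factor of the optimum. -/
theorem facLoc_le_of_ruling (hn : 1 ≤ n) {S F : Finset (Fin n)}
    (hS : ∀ i ∈ S, IsEligible I.D ρ i)
    (hSdom : ∀ i, IsEligible I.D ρ i → ∃ j ∈ S, Near I.D ρ i j) (hFS : F ⊆ S)
    (hind : ∀ i ∈ F, ∀ j ∈ F, i ≠ j → ¬ Near I.D ρ i j)
    (hFdom : ∀ i ∈ S, ∃ j ∈ F, Near I.D ρ i j) :
    ∃ hF : F.Nonempty, I.facLoc F hF ≤ 54 * I.opt := by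
  have : Nonempty (Fin n) := ⟨⟨0, hn⟩⟩
  have hmin : ∀ j, ∃ k, ∀ l, I.D j k + ρ k ≤ I.D j l + ρ l := fun j =>
    Finite.exists_min fun k => I.D j k + ρ k
  choose g hg using hmin
  set r : Fin n → ℝ := fun j => I.D j (g j) + ρ (g j) with hr
  -- With `ρ` the radius of `g j`, the hops from `g j` to `a`, `b` and `c` cost at most `4 * ρ`, `4
  -- * ρ` and `8 * ρ`, the last because the radius of `b` may be `2 * ρ`.
  have hcover : ∀ j, ∃ i ∈ F, I.D i j ≤ 16 * r j := by
    intro j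
    obtain ⟨a, ha, hga, hρa⟩ := exists_isEligible hρ (g j)
    obtain ⟨b, hbS, hab⟩ := hSdom a ha
    obtain ⟨c, hcF, hbc⟩ := hFdom b hbS
    have hb := hS b hbS
    have hc := hS c (hFS hcF)
    refine ⟨c, hcF, ?_⟩
    have h₁ := hab.radius_le hρ hb
    have h₂ := hab.D_le hρ hb
    have h₃ := hbc.D_le hρ hc
    have h₄ := I.D_triangle j (g j) c
    have h₅ := I.D_triangle (g j) a c
    have h₆ := I.D_triangle a b c
    have h₇ := I.D_nonneg j (g j)
    rw [I.D_comm c j]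
    change I.D j c ≤ 16 * (I.D j (g j) + ρ (g j))
    linarith
  have hF : F.Nonempty := by
    obtain ⟨i, hi, -⟩ := hcover ⟨0, hn⟩
    exact ⟨i, hi⟩
  refine ⟨hF, ?_⟩
  have hopen := sum_openCost_le hρ (r := r) (fun j => ⟨g j, rfl⟩) (fun i hi => hS i (hFS hi)) hind
  have hconn : (∑ j, F.inf' hF fun i => I.D i j) ≤ 16 * ∑ j, r j := by
    rw [Finset.mul_sum]
    refine Finset.sum_le_sum fun j _ => ?_
    obtain ⟨i, hi, hij⟩ := hcover j
    exact (Finset.inf'_le (fun i => I.D i j) hi).trans hij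
  have : Nonempty {F : Finset (Fin n) // F.Nonempty} := ⟨⟨F, hF⟩⟩
  have hopt : (∑ j, r j) / 3 ≤ I.opt := by
    refine le_ciInf fun G => ?_
    have := sum_le_three_mul_facLoc hρ (r := r) (fun j k => hg j k) G.1 G.2
    linarith
  rw [Instance.facLoc]
  linarith

end Conflicts

open Classical

/-! ### Routing -/

section Routing

variable {n : ℕ}

/-- The position of the pair `(i, j)`, `j ∈ A`, in the lexicographic enumeration of all pairs, if
`d` pairs begin with each node and `A` is the set of second components of the pairs beginning
with `i`. -/
def slot (d : Fin n → ℕ) (A : Finset (Fin n)) (i j : Fin n) : ℕ :=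
  (∑ l with l < i, d l) + (A.filter fun l => l < j).card

/-- The message that node `i` sends to node `u` in order to distribute its pairs. -/
def outgoing (d : Fin n → ℕ) (A : Finset (Fin n)) (i u : Fin n) : Option (Fin n × Fin n) :=
  if h : ∃ x : Fin n × Fin n, x.1 ∈ A ∧ slot d A i x.1 = x.2 * n + u then some h.choose else none

/-- The pair that a node having received the messages `m` announces in the `q`-th round. -/
def relay (m : Fin n → Option (Fin n × Fin n)) (q : ℕ) : Option (Fin n × Fin n) :=
  if h : ∃ e : Fin n × Fin n, ∃ r : Fin n, m e.1 = some (e.2, r) ∧ (r : ℕ) = q then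
    some h.choose else none

theorem slot_strictMono {d : Fin n → ℕ} {A : Finset (Fin n)} {i j j' : Fin n} (hj : j ∈ A)
    (h : j < j') : slot d A i j < slot d A i j' := by
  refine Nat.add_lt_add_left (Finset.card_lt_card ?_) _
  refine (Finset.ssubset_iff_of_subset ?_).2 ⟨j, ?_, ?_⟩
  · exact Finset.monotone_filter_right _ fun l _ hl => lt_trans hl h
  · exact Finset.mem_filter.2 ⟨hj, h⟩
  · simp

theorem slot_injOn {d : Fin n → ℕ} {A : Finset (Fin n)} {i j j' : Fin n} (hj : j ∈ A)
    (hj' : j' ∈ A) (h : slot d A i j = slot d A i j') : j = j' := by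
  rcases lt_trichotomy j j' with hlt | heq | hlt
  · exact absurd h (slot_strictMono hj hlt).ne
  · exact heq
  · exact absurd h (slot_strictMono hj' hlt).ne'

theorem slot_lt {d : Fin n → ℕ} {A : Finset (Fin n)} {i j : Fin n} (hd : d i = A.card)
    (hj : j ∈ A) : slot d A i j < (∑ l with l < i, d l) + d i := by
  refine Nat.add_lt_add_left (hd ▸ Finset.card_lt_card ?_) _
  exact (Finset.ssubset_iff_of_subset (Finset.filter_subset _ _)).2 ⟨j, hj, by simp⟩

theorem sum_lt_add_le (d : Fin n → ℕ) {i : Fin n} {T : Finset (Fin n)}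
    (hT : ∀ l ≤ i, l ∈ T) : (∑ l with l < i, d l) + d i ≤ ∑ l ∈ T, d l := by
  rw [add_comm, ← Finset.sum_insert (by simp)]
  refine Finset.sum_le_sum_of_subset fun l hl => hT l ?_
  simp only [Finset.mem_insert, Finset.mem_filter, Finset.mem_univ, true_and] at hl
  exact hl.elim le_of_eq le_of_lt

theorem slot_injective {N : Fin n → Finset (Fin n)} {i i' j j' : Fin n} (hj : j ∈ N i)
    (hj' : j' ∈ N i')
    (h : slot (fun l => (N l).card) (N i) i j = slot (fun l => (N l).card) (N i') i' j') :
    i = i' ∧ j = j' := by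
  have key : ∀ {a a' c c' : Fin n}, c ∈ N a → a < a' →
      slot (fun l => (N l).card) (N a) a c < slot (fun l => (N l).card) (N a') a' c' := by
    intro a a' c c' hc haa
    refine (slot_lt rfl hc).trans_le ((sum_lt_add_le _ fun l hl => ?_).trans (Nat.le_add_right _ _))
    simpa using lt_of_le_of_lt hl haa
  rcases lt_trichotomy i i' with hlt | rfl | hlt
  · exact absurd h (key hj hlt).ne
  · exact ⟨rfl, slot_injOn hj hj' h⟩
  · exact absurd h (key hj' hlt).ne'

theorem outgoing_eq_some {d : Fin n → ℕ} {A : Finset (Fin n)} {i u : Fin n} {x : Fin n × Fin n}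
    (h : outgoing d A i u = some x) : x.1 ∈ A ∧ slot d A i x.1 = x.2 * n + u := by
  rw [outgoing] at h
  split_ifs at h with hx
  have := hx.choose_spec
  rwa [Option.some.inj h] at this

/-- The slots of `i` lie in an interval of length at most `n`, so no two are congruent modulo `n`:
one message per link suffices. -/
theorem outgoing_slot {d : Fin n → ℕ} {A : Finset (Fin n)} {i j u r : Fin n}
    (hd : d i = A.card) (hA : A.card ≤ n) (hj : j ∈ A) (h : slot d A i j = r * n + u) :
    outgoing d A i u = some (j, r) := by
  have hex : ∃ x : Fin n × Fin n, x.1 ∈ A ∧ slot d A i x.1 = x.2 * n + u := ⟨(j, r), hj, h⟩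
  obtain ⟨x, hx⟩ : ∃ x, outgoing d A i u = some x := ⟨_, dif_pos hex⟩
  obtain ⟨hxA, hxs⟩ := outgoing_eq_some hx
  have h₁ := slot_lt hd hj
  have h₂ := slot_lt hd hxA
  have h₃ : (∑ l with l < i, d l) ≤ slot d A i j := Nat.le_add_right _ _
  have h₄ : (∑ l with l < i, d l) ≤ slot d A i x.1 := Nat.le_add_right _ _
  have hr : (x.2 : ℕ) = r := by
    rcases lt_trichotomy (x.2 : ℕ) r with hlt | heq | hlt
    · have := Nat.mul_le_mul_right n (Nat.succ_le_of_lt hlt)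
      rw [Nat.succ_mul] at this
      omega
    · exact heq
    · have := Nat.mul_le_mul_right n (Nat.succ_le_of_lt hlt)
      rw [Nat.succ_mul] at this
      omega
  have hxj : x.1 = j := slot_injOn hxA hj (by rw [hxs, h, hr])
  rw [hx, ← hxj, ← Fin.ext hr]

theorem relay_eq_some {m : Fin n → Option (Fin n × Fin n)} {q : ℕ} {e : Fin n × Fin n}
    (h : relay m q = some e) : ∃ r : Fin n, m e.1 = some (e.2, r) ∧ (r : ℕ) = q := by
  rw [relay] at h
  split_ifs at h with he
  have := he.choose_spec
  rwa [Option.some.inj h] at this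

/-- After the pairs have been distributed, the number of rounds needed to announce all of them is
about the number of pairs divided by the number of nodes. -/
theorem exists_relay_iff {N : Fin n → Finset (Fin n)} (hN : ∀ i, (N i).card ≤ n) (i j : Fin n) :
    (∃ u : Fin n, ∃ q < (∑ l, (N l).card) / n + 1,
      relay (fun a => outgoing (fun l => (N l).card) (N a) a u) q = some (i, j)) ↔ j ∈ N i := by
  constructor
  · rintro ⟨u, q, -, h⟩
    obtain ⟨r, hr, -⟩ := relay_eq_some h
    exact (outgoing_eq_some hr).1
  · intro hj
    have hn : 0 < n := i.pos
    have hlt : slot (fun l => (N l).card) (N i) i j < ∑ l, (N l).card :=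
      (slot_lt rfl hj).trans_le (sum_lt_add_le (fun l => (N l).card) (by simp))
    have hle : ∑ l, (N l).card ≤ n * n := by
      refine (Finset.sum_le_card_nsmul _ _ n fun l _ => hN l).trans ?_
      simp
    set s := slot (fun l => (N l).card) (N i) i j with hs
    -- The pair in slot `s` is sent to node `s % n` and announced in relay round `s / n`, which thus
    -- fits into an identifier.
    have hq : s / n < n := Nat.div_lt_of_lt_mul (hlt.trans_le hle)
    refine ⟨⟨s % n, Nat.mod_lt _ hn⟩, s / n, Nat.lt_succ_of_le (Nat.div_le_div_right hlt.le), ?_⟩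
    have hout := outgoing_slot (u := ⟨s % n, Nat.mod_lt _ hn⟩) (r := ⟨s / n, hq⟩)
      (d := fun l => (N l).card) (i := i) rfl (hN i) hj
      (by simp only [← hs]; exact (Nat.div_add_mod' s n).symm)
    have hex : ∃ e : Fin n × Fin n, ∃ r : Fin n,
        outgoing (fun l => (N l).card) (N e.1) e.1 ⟨s % n, Nat.mod_lt _ hn⟩ = some (e.2, r) ∧
          (r : ℕ) = s / n := ⟨(i, j), ⟨s / n, hq⟩, hout, rfl⟩
    obtain ⟨e, he⟩ : ∃ e, relay (fun a => outgoing (fun l => (N l).card) (N a) a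
      ⟨s % n, Nat.mod_lt _ hn⟩) (s / n) = some e := ⟨_, dif_pos hex⟩
    obtain ⟨r, hr, hrq⟩ := relay_eq_some he
    obtain ⟨heN, hes⟩ := outgoing_eq_some hr
    simp only [hrq, Nat.div_add_mod'] at hes
    obtain ⟨h₁, h₂⟩ := slot_injective heN hj hes
    rw [he, ← h₁, ← h₂]

end Routing

/-! ### Maximal independent sets and nearest points -/

section Local

variable {n : ℕ}

theorem exists_maximal_independent (S : Finset (Fin n)) (E : Fin n → Fin n → Prop) :
    ∃ F ⊆ S, (∀ i ∈ F, ∀ j ∈ F, i ≠ j → ¬ E i j) ∧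
      ∀ i ∈ S, i ∈ F ∨ ∃ j ∈ F, E i j ∨ E j i := by
  obtain ⟨F, hF⟩ := (S.powerset.filter fun F => ∀ i ∈ F, ∀ j ∈ F, i ≠ j → ¬ E i j).exists_maximal
    ⟨∅, by simp⟩
  have hFm := Finset.mem_filter.1 hF.1
  rw [Finset.mem_powerset] at hFm
  refine ⟨F, hFm.1, hFm.2, fun i hi => ?_⟩
  by_contra! hcon
  refine hcon.1 (hF.2 (y := insert i F) ?_ (Finset.subset_insert i F) (Finset.mem_insert_self i F))
  refine Finset.mem_filter.2 ⟨Finset.mem_powerset.2 (Finset.insert_subset hi hFm.1), ?_⟩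
  intro a ha b hb hab
  rcases Finset.mem_insert.1 ha with rfl | ha' <;> rcases Finset.mem_insert.1 hb with rfl | hb'
  · exact absurd rfl hab
  · exact (hcon.2 b hb').1
  · exact (hcon.2 a ha').2
  · exact hFm.2 a ha' b hb' hab

/-- A maximal independent subset of `S`. -/
def maximalIndependent (S : Finset (Fin n)) (E : Fin n → Fin n → Prop) : Finset (Fin n) :=
  (exists_maximal_independent S E).choose

/-- A point of `F` with the least value of `δ`. -/
def nearest (δ : Fin n → ℝ) (F : Finset (Fin n)) (i : Fin n) : Fin n :=
  if h : ∃ k ∈ F, ∀ l ∈ F, δ k ≤ δ l then h.choose else i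

theorem nearest_spec (δ : Fin n → ℝ) {F : Finset (Fin n)} (hF : F.Nonempty) (i : Fin n) :
    nearest δ F i ∈ F ∧ ∀ l ∈ F, δ (nearest δ F i) ≤ δ l := by
  have h : ∃ k ∈ F, ∀ l ∈ F, δ k ≤ δ l := Finset.exists_min_image F δ hF
  rw [nearest, dif_pos h]
  exact h.choose_spec

/-- Distinct nodes have positive distance, so an open node can only be nearest to itself. -/
theorem isApproxSolution_nearest {I : Instance n} {α : ℝ} {F : Finset (Fin n)} (hF : F.Nonempty)
    (h : I.facLoc F hF ≤ α * I.opt) :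
    I.IsApproxSolution α fun i => nearest (I.localInput i).distTo F i := by
  refine ⟨F, hF, fun i => ⟨fun hi => ?_, fun hi => ?_⟩, fun i => nearest_spec _ hF i, h⟩
  · have h₁ := (nearest_spec (I.localInput i).distTo hF i).2 i hi
    refine (I.eq_of_D_eq_zero (le_antisymm (h₁.trans (I.D_self i).le) (I.D_nonneg _ _))).symm
  · have h₁ := (nearest_spec (I.localInput i).distTo hF i).1
    exact hi ▸ h₁

end Local

/-! ### Codes -/

theorem lt_two_pow_logBits (n : ℕ) : n + 1 ≤ 2 ^ logBits n := Nat.le_pow_clog (by norm_num) _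

theorem card_bitVec (w : ℕ) : Fintype.card (BitVec w) = 2 ^ w := by
  rw [← FinEnum.card_eq_fintypeCard, FinEnum.card_bitVec]

theorem nonempty_pairCode (n : ℕ) :
    Nonempty (Option (Fin n × Fin n) ↪ BitVec (2 * logBits n)) := by
  refine Function.Embedding.nonempty_of_card_le ?_
  have h := lt_two_pow_logBits n
  simp only [Fintype.card_option, Fintype.card_prod, Fintype.card_fin, card_bitVec]
  calc
    n * n + 1 ≤ (n + 1) * (n + 1) := by nlinarith
    _ ≤ 2 ^ logBits n * 2 ^ logBits n := Nat.mul_le_mul h h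
    _ = 2 ^ (2 * logBits n) := by rw [two_mul, pow_add]

theorem nonempty_chunkCode (n b : ℕ) : Nonempty
    (BitVec (b * logBits n) × Fin (n + 1) ↪ (Fin (b + 1) → BitVec (2 * logBits n))) := by
  refine Function.Embedding.nonempty_of_card_le ?_
  have h := lt_two_pow_logBits n
  simp only [Fintype.card_prod, Fintype.card_fin, card_bitVec, Fintype.card_pi, Finset.prod_const,
    Finset.card_univ]
  calc
    2 ^ (b * logBits n) * (n + 1) ≤ 2 ^ (b * logBits n) * 2 ^ logBits n := by gcongr
    _ = 2 ^ (logBits n * (b + 1)) := by rw [← pow_add]; ring_nf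
    _ ≤ 2 ^ (2 * logBits n * (b + 1)) := by gcongr <;> omega
    _ = (2 ^ (2 * logBits n)) ^ (b + 1) := by rw [pow_mul]

/-- An injective code for pairs of nodes. -/
def pairCode (n : ℕ) : Option (Fin n × Fin n) ↪ BitVec (2 * logBits n) := (nonempty_pairCode n).some

/-- An injective code, split into short messages, for numbers with a denominator. -/
def chunkCode (n b : ℕ) :
    BitVec (b * logBits n) × Fin (n + 1) ↪ (Fin (b + 1) → BitVec (2 * logBits n)) :=
  (nonempty_chunkCode n b).some

/-! ### The facility location scheme -/

section FacilityScheme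

variable {n b K : ℕ} (enc : BitVec (b * logBits n) → ℝ)

/-- A description of the radius of a node. -/
def NodeInput.packet (z : NodeInput n) : BitVec (b * logBits n) × Fin (n + 1) :=
  if h : ∃ x, z.IsRadius (ratioValue enc x) then h.choose else (0, 0)

/-- The radius of a node. -/
def radius (I : Instance n) (i : Fin n) : ℝ := ratioValue enc ((I.localInput i).packet enc)

theorem isRadius_radius {I : Instance n} (hI : I.RepresentedBy enc) (i : Fin n) :
    (I.localInput i).IsRadius (radius enc I i) := by
  have h := I.exists_isRadius hI i
  rw [radius, NodeInput.packet, dif_pos h]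
  exact h.choose_spec

/-- The coin of node `i` in phase `l`. -/
def coinAt (ω : Fin n → Fin K → Bool) (l : ℕ) (i : Fin n) : Bool :=
  if h : l < K then ω i ⟨l, h⟩ else false

/-- The facilities sampled in the first `k` phases. -/
def chosen (I : Instance n) (ω : Fin n → Fin K → Bool) (k : ℕ) : Finset (Fin n) :=
  selection (Near I.D (radius enc I)) (Finset.univ.filter (IsEligible I.D (radius enc I))) k
    fun l i => coinAt ω l i

theorem mem_chosen_succ (I : Instance n) (ω : Fin n → Fin K → Bool) (k : ℕ) (i : Fin n) :
    i ∈ chosen enc I ω (k + 1) ↔ i ∈ chosen enc I ω k ∨ (IsEligible I.D (radius enc I) i ∧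
      ∀ j ∈ chosen enc I ω k, ¬ Near I.D (radius enc I) i j) ∧ coinAt ω k i = true := by
  change i ∈ sample _ _ _ (chosen enc I ω k) ↔ _
  simp [sample, remaining]

/-- The sampled facilities that are in conflict with the sampled facility `i`. -/
def links (I : Instance n) (ω : Fin n → Fin K → Bool) (i : Fin n) : Finset (Fin n) :=
  if i ∈ chosen enc I ω K then nbrs (Near I.D (radius enc I)) (chosen enc I ω K) i else ∅

theorem mem_links (I : Instance n) (ω : Fin n → Fin K → Bool) (i j : Fin n) :
    j ∈ links enc I ω i ↔ i ∈ chosen enc I ω K ∧ j ∈ chosen enc I ω K ∧ j ≠ i ∧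
      Near I.D (radius enc I) i j := by
  rw [links]
  split_ifs with h <;> simp [nbrs, h]

/-- The strict bound lets a degree be sent as if it were an identifier. -/
theorem card_links_lt (I : Instance n) (ω : Fin n → Fin K → Bool) (i : Fin n) :
    (links enc I ω i).card < n := by
  rw [links]
  split_ifs
  · exact card_nbrs_lt _ _
  · exact i.pos

theorem sum_card_links (I : Instance n) (ω : Fin n → Fin K → Bool) :
    ∑ i, (links enc I ω i).card = pairs (Near I.D (radius enc I)) (chosen enc I ω K) := by
  simp only [links, pairs, apply_ite Finset.card, Finset.card_empty, Finset.sum_ite_mem,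
    Finset.univ_inter]

/-- The message that node `i` sends to node `u` when the links are distributed. -/
def transfer (I : Instance n) (ω : Fin n → Fin K → Bool) (i u : Fin n) :
    Option (Fin n × Fin n) :=
  outgoing (fun l => (links enc I ω l).card) (links enc I ω i) i u

/-- The message that node `i` sends to node `j` in round `t`: first all nodes announce their radii,
then who is sampled in the phases, then the numbers of their links, and finally all links are
distributed and announced. -/
def message (I : Instance n) (ω : Fin n → Fin K → Bool) (t : ℕ) (i j : Fin n) :
    BitVec (2 * logBits n) :=
  if h : t < b + 1 then chunkCode n b ((I.localInput i).packet enc) ⟨t, h⟩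
  else if t < b + 1 + K then
    pairCode n (if i ∈ chosen enc I ω (t - (b + 1) + 1) then some (i, i) else none)
  else if t = b + 1 + K then
    pairCode n (some (⟨(links enc I ω i).card, card_links_lt enc I ω i⟩, i))
  else if t = b + 1 + K + 1 then pairCode n (transfer enc I ω i j)
  else pairCode n (relay (fun l => transfer enc I ω l i) (t - (b + 1 + K + 2)))

theorem message_chunk (I : Instance n) (ω : Fin n → Fin K → Bool) (s : Fin (b + 1))
    (i j : Fin n) :
    message enc I ω s i j = chunkCode n b ((I.localInput i).packet enc) s := by
  rw [message, dif_pos s.2]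

theorem message_sampled (I : Instance n) (ω : Fin n → Fin K → Bool) {k : ℕ} (hk : k < K)
    (i j : Fin n) : message enc I ω (b + 1 + k) i j =
      pairCode n (if i ∈ chosen enc I ω (k + 1) then some (i, i) else none) := by
  rw [message, dif_neg (by omega), if_pos (by omega), Nat.add_sub_cancel_left]

theorem message_degree (I : Instance n) (ω : Fin n → Fin K → Bool) (i j : Fin n) :
    message enc I ω (b + 1 + K) i j =
      pairCode n (some (⟨(links enc I ω i).card, card_links_lt enc I ω i⟩, i)) := by
  rw [message, dif_neg (by omega), if_neg (by omega), if_pos rfl]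

theorem message_transfer (I : Instance n) (ω : Fin n → Fin K → Bool) (i j : Fin n) :
    message enc I ω (b + 1 + K + 1) i j = pairCode n (transfer enc I ω i j) := by
  rw [message, dif_neg (by omega), if_neg (by omega), if_neg (by omega), if_pos rfl]

theorem message_relay (I : Instance n) (ω : Fin n → Fin K → Bool) (q : ℕ) (i j : Fin n) :
    message enc I ω (b + 1 + K + 2 + q) i j =
      pairCode n (relay (fun l => transfer enc I ω l i) q) := by
  rw [message, dif_neg (by omega), if_neg (by omega), if_neg (by omega), if_neg (by omega),
    Nat.add_sub_cancel_left]

/-- The number of rounds. -/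
def duration (I : Instance n) (ω : Fin n → Fin K → Bool) : ℕ :=
  b + 1 + K + 2 + ((∑ i, (links enc I ω i).card) / n + 1)

theorem lt_duration (I : Instance n) (ω : Fin n → Fin K → Bool) :
    b + 1 + K < duration enc I ω := by
  rw [duration, Nat.add_assoc (b + 1 + K)]
  exact Nat.lt_add_of_pos_right (Nat.add_pos_left two_pos _)

/-- The facilities that are opened. -/
def opened (I : Instance n) (ω : Fin n → Fin K → Bool) : Finset (Fin n) :=
  maximalIndependent (chosen enc I ω K) fun i j => j ∈ links enc I ω i

/-! ### What a node can deduce from the messages it has received -/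

section Knowledge

variable {enc} {I I' : Instance n} {ω ω' : Fin n → Fin K → Bool} {t : ℕ} {i : Fin n}
  (hI : I.localInput i = I'.localInput i) (hω : ω i = ω' i)
  (h : ∀ s < t, ∀ j, message enc I ω s j i = message enc I' ω' s j i)

include h

theorem radius_eq_of_message_eq (ht : b + 1 ≤ t) : radius enc I = radius enc I' := by
  funext j
  have : (I.localInput j).packet enc = (I'.localInput j).packet enc := by
    refine (chunkCode n b).injective (funext fun s => ?_)
    simpa only [message_chunk] using h s (s.2.trans_le ht) j
  rw [radius, radius, this]

theorem chosen_eq_of_message_eq {k : ℕ} (hk : k ≤ K) (ht : b + 1 + k ≤ t) :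
    chosen enc I ω k = chosen enc I' ω' k := by
  cases k with
  | zero => rfl
  | succ k =>
    ext j
    have := h (b + 1 + k) (by omega) j
    rw [message_sampled enc I ω hk, message_sampled enc I' ω' hk] at this
    have := (pairCode n).injective this
    by_cases h₁ : j ∈ chosen enc I ω (k + 1) <;> by_cases h₂ : j ∈ chosen enc I' ω' (k + 1) <;>
      simp_all

theorem card_links_eq_of_message_eq (ht : b + 1 + K < t) (j : Fin n) :
    (links enc I ω j).card = (links enc I' ω' j).card := by
  have := h (b + 1 + K) ht j
  rw [message_degree, message_degree] at this
  simpa using (pairCode n).injective this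

theorem transfer_eq_of_message_eq (ht : b + 1 + K + 1 < t) (j : Fin n) :
    transfer enc I ω j i = transfer enc I' ω' j i := by
  have := h (b + 1 + K + 1) ht j
  rw [message_transfer, message_transfer] at this
  exact (pairCode n).injective this

theorem relay_eq_of_message_eq {q : ℕ} (ht : b + 1 + K + 2 + q < t) (j : Fin n) :
    relay (fun l => transfer enc I ω l j) q = relay (fun l => transfer enc I' ω' l j) q := by
  have := h (b + 1 + K + 2 + q) ht j
  rw [message_relay, message_relay] at this
  exact (pairCode n).injective this

/-- Equal degrees give both executions the same number of relay rounds, and the relayed pairs are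
exactly the links. -/
theorem links_eq_of_message_eq (ht : duration enc I ω ≤ t) :
    links enc I ω = links enc I' ω' := by
  have hlt : b + 1 + K < t := (lt_duration enc I ω).trans_le ht
  have hcard := card_links_eq_of_message_eq h hlt
  funext j
  ext l
  rw [← exists_relay_iff (fun a => (card_links_lt enc I ω a).le),
    ← exists_relay_iff (fun a => (card_links_lt enc I' ω' a).le)]
  simp only [← hcard]
  refine exists_congr fun u => exists_congr fun q => and_congr_right fun hq => ?_
  have := relay_eq_of_message_eq h (q := q) (by rw [duration] at ht; omega) u
  simp only [transfer, ← hcard] at this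
  rw [this]

theorem opened_eq_of_message_eq (ht : duration enc I ω ≤ t) :
    opened enc I ω = opened enc I' ω' := by
  have hlt : b + 1 + K ≤ t := ((lt_duration enc I ω).trans_le ht).le
  rw [opened, opened, links_eq_of_message_eq h ht, chosen_eq_of_message_eq h le_rfl hlt]

include hI

theorem links_self_eq_of_message_eq (ht : b + 1 + K ≤ t) :
    links enc I ω i = links enc I' ω' i := by
  have hρ := radius_eq_of_message_eq h (by omega)
  have hS := chosen_eq_of_message_eq h le_rfl ht
  have hD : I.D i = I'.D i := congrArg NodeInput.distTo hI
  ext j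
  rw [mem_links, mem_links, Near, Near, hρ, hS, hD]

include hω

theorem message_eq_of_message_eq : message enc I ω t i = message enc I' ω' t i := by
  funext j
  have hD : I.D i = I'.D i := congrArg NodeInput.distTo hI
  rcases lt_or_ge t (b + 1) with h₁ | h₁
  · rw [message_chunk enc I ω ⟨t, h₁⟩, message_chunk enc I' ω' ⟨t, h₁⟩, hI]
  have hρ := radius_eq_of_message_eq h h₁
  obtain ⟨k, rfl⟩ := Nat.exists_eq_add_of_le h₁
  rcases lt_or_ge k K with h₂ | h₂
  · have hS := chosen_eq_of_message_eq h h₂.le le_rfl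
    rw [message_sampled enc I ω h₂, message_sampled enc I' ω' h₂]
    have hiff : i ∈ chosen enc I ω (k + 1) ↔ i ∈ chosen enc I' ω' (k + 1) := by
      simp only [mem_chosen_succ, IsEligible, Near, coinAt, hρ, hS, hD, hω]
    simp only [hiff]
  obtain ⟨r, rfl⟩ := Nat.exists_eq_add_of_le h₂
  have hlinks := links_self_eq_of_message_eq hI h (by omega)
  match r with
  | 0 =>
    rw [show b + 1 + (K + 0) = b + 1 + K from rfl, message_degree, message_degree]
    simp only [hlinks]
  | 1 =>
    rw [← Nat.add_assoc, message_transfer, message_transfer, transfer, transfer, hlinks]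
    simp only [card_links_eq_of_message_eq h (by omega : b + 1 + K < b + 1 + (K + 1))]
  | q + 2 =>
    rw [show b + 1 + (K + (q + 2)) = b + 1 + K + 2 + q by omega, message_relay, message_relay]
    simp only [transfer_eq_of_message_eq h (by omega : b + 1 + K + 1 < b + 1 + (K + (q + 2)))]

end Knowledge

variable (K) in
/-- The facility location scheme with sampling rates given by `μ`. -/
abbrev facilityScheme (μ : ℕ → PMF Bool) : Scheme n (2 * logBits n) (NodeInput n) (Fin n) where
  Config := {I : Instance n // I.RepresentedBy enc}
  Seed := Fin K → Bool
  law := indep fun l : Fin K => μ l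
  input I := I.1.localInput
  msg I := message enc I.1
  time I := duration enc I.1
  out I ω i := nearest (I.1.localInput i).distTo (opened enc I.1 ω) i
  msg_determined hI hω h := message_eq_of_message_eq hI hω h
  out_determined hI _ h ht := by
    rw [hI, opened_eq_of_message_eq (fun s hs j => (h s hs j).symm) ht]

theorem isApproxSolution_of_coin {I : Instance n} (hI : I.RepresentedBy enc) (hn : 1 ≤ n)
    {ω : Fin n → Fin (K + 1) → Bool} (hω : ∀ i, ω i (Fin.last K) = true) :
    I.IsApproxSolution 54 fun i => nearest (I.localInput i).distTo (opened enc I ω) i := by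
  have hρ := isRadius_radius enc hI
  obtain ⟨hFS, hind, hdom⟩ := (exists_maximal_independent (chosen enc I ω (K + 1))
    fun i j => j ∈ links enc I ω i).choose_spec
  have hlinks : ∀ {i j}, j ∈ links enc I ω i → Near I.D (radius enc I) i j := by
    intro i j hj
    exact ((mem_links enc I ω i j).1 hj).2.2.2
  obtain ⟨hF, hle⟩ := facLoc_le_of_ruling hρ hn (S := chosen enc I ω (K + 1))
    (F := opened enc I ω)
    (fun i hi => (Finset.mem_filter.1 (selection_subset _ _ hi)).2)
    (fun i hi => exists_near_selection (near_self hρ)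
      (fun i => by simpa [coinAt, Fin.last] using hω i) (by simpa using hi)) hFS
    (fun i hi j hj hij hnear => hind i hi j hj hij
      ((mem_links enc I ω i j).2 ⟨hFS hi, hFS hj, hij.symm, hnear⟩))
    (fun i hi => by
      rcases hdom i hi with h | ⟨j, hj, h⟩
      · exact ⟨i, h, near_self hρ i⟩
      · exact ⟨j, hj, h.elim hlinks fun h => (hlinks h).symm⟩)
  exact isApproxSolution_nearest hF hle

/-- Every seed vector of positive probability shows only heads in the last phase, so domination
never fails. -/
theorem facilityScheme_correct {I : Instance n} (hI : I.RepresentedBy enc) (hn : 1 ≤ n)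
    (μ : ℕ → PMF Bool) (hμ : μ K false = 0) :
    (facilityScheme (K + 1) enc μ).toAlgorithm.Correct I.localInput (I.IsApproxSolution 54) := by
  refine (facilityScheme (K + 1) enc μ).correct_toAlgorithm ⟨I, hI⟩ fun ω hω => ?_
  refine isApproxSolution_of_coin enc hI hn fun i => ?_
  rw [PMF.mem_support_iff, indep_apply, Finset.prod_ne_zero_iff] at hω
  have h₁ := hω i (Finset.mem_univ i)
  change (indep fun l : Fin (K + 1) => μ l) (ω i) ≠ 0 at h₁
  rw [indep_apply, Finset.prod_ne_zero_iff] at h₁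
  have h₂ := h₁ (Fin.last K) (Finset.mem_univ _)
  rw [Fin.val_last] at h₂
  by_contra hcon
  rw [Bool.not_eq_true] at hcon
  rw [hcon] at h₂
  exact h₂ hμ

theorem facilityScheme_expectedRounds_le {I : Instance n} (hI : I.RepresentedBy enc) (hn : 1 ≤ n)
    (μ : ℕ → PMF Bool) (h₀ : μ 0 true ^ 2 * n ≤ 2)
    (hμ : ∀ k, μ (k + 1) true ^ 2 ≤ 2 * μ k true) :
    (facilityScheme K enc μ).toAlgorithm.expectedRounds I.localInput ≤ (b + 4 + 3 * K : ℕ) := by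
  refine ((facilityScheme K enc μ).expectedRounds_toAlgorithm_le ⟨I, hI⟩).trans ?_
  have hn₀ : (n : ℝ≥0∞) ≠ 0 := by exact_mod_cast (by omega : n ≠ 0)
  have hn₁ : (n : ℝ≥0∞) ≠ ⊤ := ENNReal.natCast_ne_top n
  have key := tsum_indep_indep μ K fun c => ((b + 4 + K : ℕ) : ℝ≥0∞) + (n : ℝ≥0∞)⁻¹ *
    (pairs (Near I.D (radius enc I)) (selection (Near I.D (radius enc I))
      (Finset.univ.filter (IsEligible I.D (radius enc I))) K c) : ℝ≥0∞)
  calc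
    _ ≤ ∑' ω : Fin n → Fin K → Bool, (indep fun _ => indep fun l : Fin K => μ l) ω *
        (((b + 4 + K : ℕ) : ℝ≥0∞) + (n : ℝ≥0∞)⁻¹ *
          (pairs (Near I.D (radius enc I)) (selection (Near I.D (radius enc I))
            (Finset.univ.filter (IsEligible I.D (radius enc I))) K fun l i => ω i l) : ℝ≥0∞)) := by
      refine ENNReal.tsum_le_tsum fun ω => ?_
      change _ * (duration enc I ω : ℝ≥0∞) ≤ _
      gcongr
      have hsel : chosen enc I ω K = selection (Near I.D (radius enc I))
          (Finset.univ.filter (IsEligible I.D (radius enc I))) K fun l i => ω i l := by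
        rw [chosen]
        congr 1
        funext l i
        simp [coinAt]
      rw [duration, sum_card_links, hsel]
      set m := pairs _ _
      have hdiv : ((m / n : ℕ) : ℝ≥0∞) ≤ (n : ℝ≥0∞)⁻¹ * m := by
        rw [mul_comm, ← div_eq_mul_inv, ENNReal.le_div_iff_mul_le (Or.inl hn₀) (Or.inl hn₁)]
        exact_mod_cast Nat.div_mul_le_self m n
      calc
        ((b + 1 + K + 2 + (m / n + 1) : ℕ) : ℝ≥0∞) = ((b + 4 + K : ℕ) : ℝ≥0∞) + (m / n : ℕ) := by
          push_cast
          ring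
        _ ≤ _ := by gcongr
    _ ≤ (b + 4 + K : ℕ) + (n : ℝ≥0∞)⁻¹ * (2 * n * K) := by
      rw [key, expect_add, expect_const, expect_const_mul]
      gcongr
      exact expect_pairs_selection_le (fun i j h => h.symm) μ h₀ hμ K
    _ = (b + 4 + K : ℕ) + ((n : ℝ≥0∞)⁻¹ * n) * (2 * K) := by ring
    _ = (b + 4 + 3 * K : ℕ) := by
      rw [ENNReal.inv_mul_cancel hn₀ hn₁]
      push_cast
      ring

end FacilityScheme

/-! ### Sampling rates -/

/-- The sampling rate in phase `k` if phase `J` is the last one. -/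
def rate (J k : ℕ) : ℝ≥0∞ := (1 / 2) ^ (2 ^ (J - k) / 2)

theorem half_add_half : (1 / 2 : ℝ≥0∞) + 1 / 2 = 1 := ENNReal.add_halves 1

theorem half_le_one : (1 / 2 : ℝ≥0∞) ≤ 1 := le_self_add.trans_eq half_add_half

theorem rate_le_one (J k : ℕ) : rate J k ≤ 1 := pow_le_one₀ zero_le half_le_one

theorem rate_self (J : ℕ) : rate J J = 1 := by simp [rate]

/-- The exponent halves from phase to phase. Near the end, integer division rounds it from 1 down to
0, and the factor 2 absorbs this. -/
theorem rate_succ_sq_le (J k : ℕ) : rate J (k + 1) ^ 2 ≤ 2 * rate J k := by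
  have h₂ : (2 : ℝ≥0∞) * (1 / 2) = 1 := by rw [two_mul]; exact half_add_half
  rcases lt_or_ge (k + 1) J with h | h
  · obtain ⟨d, hd⟩ : ∃ d, J - k = d + 2 := ⟨J - k - 2, by omega⟩
    have hd' : J - (k + 1) = d + 1 := by omega
    rw [rate, rate, hd, hd', ← pow_mul, pow_succ 2 (d + 1), pow_succ 2 d,
      Nat.mul_div_cancel _ two_pos, Nat.mul_div_cancel _ two_pos]
    exact le_mul_of_one_le_left zero_le one_le_two
  · have h₁ : (1 / 2 : ℝ≥0∞) ≤ rate J k := by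
      have hexp : 2 ^ (J - k) / 2 ≤ 1 := by
        have : J - k ≤ 1 := by omega
        interval_cases J - k <;> simp
      calc
        (1 / 2 : ℝ≥0∞) = (1 / 2) ^ 1 := (pow_one _).symm
        _ ≤ _ := pow_le_pow_of_le_one zero_le half_le_one hexp
    calc
      rate J (k + 1) ^ 2 ≤ 1 := pow_le_one₀ zero_le (rate_le_one _ _)
      _ = 2 * (1 / 2) := h₂.symm
      _ ≤ _ := by gcongr

theorem rate_zero_sq_mul_le {J n : ℕ} (hn : n ≤ 2 ^ 2 ^ J) : rate J 0 ^ 2 * n ≤ 2 := by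
  have h₂ : (1 / 2 : ℝ≥0∞) * 2 = 1 := by rw [mul_two]; exact half_add_half
  cases J with
  | zero =>
    rw [rate_self, one_pow, one_mul]
    exact_mod_cast hn
  | succ J =>
    calc
      rate (J + 1) 0 ^ 2 * n ≤ rate (J + 1) 0 ^ 2 * ((2 ^ 2 ^ (J + 1) : ℕ) : ℝ≥0∞) := by
        gcongr
      _ = (1 / 2 * 2) ^ 2 ^ (J + 1) := by
        rw [rate, ← pow_mul, Nat.sub_zero, Nat.div_mul_cancel (dvd_pow_self 2 J.succ_ne_zero),
          mul_pow]
        norm_cast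
      _ ≤ 2 := by
        rw [h₂, one_pow]
        exact one_le_two

/-- The coin of phase `k` if phase `J` is the last one. -/
def phaseCoin (J k : ℕ) : PMF Bool :=
  PMF.ofFintype (fun x => cond x (rate J k) (1 - rate J k))
    (by simp [add_tsub_cancel_of_le (rate_le_one J k)])

/-- The index of the last phase. -/
def lastPhase (n : ℕ) : ℕ := Nat.clog 2 (Nat.clog 2 n)

theorem le_pow_lastPhase (n : ℕ) : n ≤ 2 ^ 2 ^ lastPhase n :=
  (Nat.le_pow_clog one_lt_two n).trans
    (Nat.pow_le_pow_right two_pos (Nat.le_pow_clog one_lt_two _))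

theorem lastPhase_le (n : ℕ) : (lastPhase n : ℝ) ≤ 5 * max 1 (Real.log (Real.log n)) := by
  set M := max 1 (Real.log (Real.log n)) with hM
  have hM₁ : 1 ≤ M := le_max_left _ _
  rcases Nat.eq_zero_or_pos (lastPhase n) with h₀ | h₀
  · rw [h₀]
    push_cast
    linarith
  · set d := lastPhase n - 1 with hd
    have hd₁ : lastPhase n = d + 1 := by omega
    have h₁ : 2 ^ d < Nat.clog 2 n := (Nat.lt_clog_iff_pow_lt one_lt_two).1 (by
      change d < lastPhase n
      omega)
    have h₂ : 2 ^ 2 ^ d < n := (Nat.lt_clog_iff_pow_lt one_lt_two).1 h₁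
    have hlog : (1 / 2 : ℝ) ≤ Real.log 2 := by linarith [Real.log_two_gt_d9]
    have h₃ : (2 : ℝ) ^ d * Real.log 2 ≤ Real.log n := by
      have : Real.log ((2 : ℝ) ^ (2 ^ d : ℕ)) ≤ Real.log n :=
        Real.log_le_log (by positivity) (by exact_mod_cast h₂.le)
      rwa [Real.log_pow, Nat.cast_pow, Nat.cast_ofNat] at this
    have h₄ : d * Real.log 2 - Real.log 2 ≤ M := by
      calc
        d * Real.log 2 - Real.log 2 = Real.log ((2 : ℝ) ^ d * (1 / 2)) := by
          rw [Real.log_mul (by positivity) (by norm_num), Real.log_pow, one_div, Real.log_inv]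
          ring
        _ ≤ Real.log (Real.log n) :=
          Real.log_le_log (by positivity) (le_trans (by gcongr) h₃)
        _ ≤ M := le_max_right _ _
    -- Since `log 2 ≥ 1 / 2`; hence `d + 1 ≤ 2 * M + 2 ≤ 4 * M`, within the claimed bound.
    have h₅ : (d : ℝ) - 1 ≤ 2 * M := by
      by_contra! hcon
      nlinarith
    rw [hd₁]
    push_cast
    linarith

end CliqueFacLoc

end

open CliqueFacLoc
theorem mainTheorem1 :
    ∃ (α : ℝ) (κ : ℕ), ∀ b : ℕ, ∃ C : ℝ,
      ∀ enc : (n : ℕ) → BitVec (b * logBits n) → ℝ,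
      ∃ A : (n : ℕ) → Algorithm n (κ * logBits n) (NodeInput n) (Fin n),
      ∀ n : ℕ, 1 ≤ n → ∀ I : Instance n, I.RepresentedBy (enc n) →
        (A n).Correct I.localInput (I.IsApproxSolution α) ∧
        (A n).expectedRounds I.localInput ≤
          ENNReal.ofReal (C * max 1 (Real.log (Real.log n))) := by
  -- With `J` the last phase and `M` the maximum in the bound, `b + 4 + 3 * (J + 1) ≤ b + 7 + 15 * M
  -- ≤ (b + 22) * M`.
  refine ⟨54, 2, fun b => ⟨b + 22, fun enc => ⟨fun n =>
    (facilityScheme (lastPhase n + 1) (enc n) (phaseCoin (lastPhase n))).toAlgorithm,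
    fun n hn I hI => ⟨?_, ?_⟩⟩⟩⟩
  · refine facilityScheme_correct (enc n) hI hn _ ?_
    simp [phaseCoin, rate_self]
  · refine (facilityScheme_expectedRounds_le (enc n) hI hn _ ?_ fun k => ?_).trans ?_
    · simpa [phaseCoin] using rate_zero_sq_mul_le (le_pow_lastPhase n)
    · simpa [phaseCoin] using rate_succ_sq_le (lastPhase n) k
    · rw [← ENNReal.ofReal_natCast]
      refine ENNReal.ofReal_le_ofReal ?_
      have h₁ := lastPhase_le n
      have h₂ : 1 ≤ max 1 (Real.log (Real.log n)) := le_max_left _ _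
      push_cast
      nlinarith [(Nat.cast_nonneg b : (0 : ℝ) ≤ b)]
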